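/- All graphs are finite, simple and undirected. For a graph $G$, a set $S\subseteq V(G)$ is a total dominating set if every vertex of $G$ is adjacent to some vertex of $S$, and $\gamma_t(G)$ is the minimum size of a total dominating set of $G$ (with $\gamma_t(G)=\infty$ if there is none, i.e. $\gamma_t(K_1)=\infty$). The eigenvalues of $G$ are those of its adjacency matrix, and $m_G(\lambda)$ is the multiplicity of $\lambda$ as an eigenvalue of $G$. $K_n$, $C_n$ and $K_{r,s}$ denote the complete graph, the cycle, and the complete bipartite graph; graphs are identified up to isomorphism. Theorem. Let $G$ be a connected graph of order $n$, and let $\lambda$ be an eigenvalue of $G$ with multiplicity $m_G(\lambda)$. Then the following hold. (i) If $\lambda\notin\mathbb{Q}$, then $\gamma_t(G)=n-m_G(\lambda)$ if and only if $(\lambda,G)=\left(\frac{-1\pm\sqrt5}{2},C_5\right)$ or $(\lambda,G)=(\pm\sqrt2,K_{1,2})$. (ii) If $\lambda\in\mathbb{Q}$, then $\lambda$ is an integer; if moreover $\gamma_t(G)=n-m_G(\lambda)$ and $(\lambda,G)\neq(2,K_3)$, then $\lambda\le 1$. Moreover, if $\lambda=0$, then $\gamma_t(G)=n-m_G(\lambda)$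 if and only if $G=K_{r,s}$ for some positive integers $r$ and $s$. -/

import Mathlib

/-- `S` is a total dominating set of `G`: every vertex of `G` (including those of `S`) is adjacent
to some vertex of `S`. -/
def SimpleGraph.IsTotalDominatingSet {V : Type*} (G : SimpleGraph V) (S : Finset V) : Prop :=
  ∀ v : V, ∃ u ∈ S, G.Adj v u

/-- The total domination number `γ_t(G)`: the minimum size of a total dominating set of `G`.
It is `⊤` if there is none, as for the graph with a single vertex. -/
noncomputable def SimpleGraph.totalDominationNumber {V : Type*} (G : SimpleGraph V) : ℕ∞ :=
  ⨅ S : {S : Finset V // G.IsTotalDominatingSet S}, (S.1.card : ℕ∞)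

/-- `lam` is an (adjacency) eigenvalue of `G`. -/
def SimpleGraph.IsAdjEigenvalue {V : Type*} [Fintype V] [DecidableEq V] (G : SimpleGraph V)
    [DecidableRel G.Adj] (lam : ℝ) : Prop :=
  Module.End.HasEigenvalue (Matrix.toLin' (G.adjMatrix ℝ)) lam

/-- The multiplicity `m_G(lam)`, as the dimension of the eigenspace; the adjacency matrix is
symmetric, so this is also the multiplicity as a root of the characteristic polynomial. In
particular it is at most the number of vertices. -/
noncomputable def SimpleGraph.adjMultiplicity {V : Type*} [Fintype V] [DecidableEq V]
    (G : SimpleGraph V) [DecidableRel G.Adj] (lam : ℝ) : ℕ :=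
  Module.finrank ℝ (Module.End.eigenspace (Matrix.toLin' (G.adjMatrix ℝ)) lam)

/-- The equality `γ_t(G) = n - m_G(lam)`, where `n` is the number of vertices. The subtraction
does not truncate, since `m_G(lam) ≤ n`. -/
def SimpleGraph.TotalDominationEquality {V : Type*} [Fintype V] [DecidableEq V]
    (G : SimpleGraph V) [DecidableRel G.Adj] (lam : ℝ) : Prop :=
  G.totalDominationNumber = ((Fintype.card V - G.adjMultiplicity lam : ℕ) : ℕ∞)

/-!
The equality `γ_t(G) = n - m_G(lam)` is studied through star complements: sets `X` of `n - m_G(lam)`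
vertices that support no nonzero eigenvector for `lam`. Each `y` outside `X` has a dual eigenvector,
equal off `X` to the indicator of `y`; its entries on `X` are, up to sign, the coordinates of the
column `y` of `A - lam` in the basis of columns indexed by `X`. A vertex `x` of `X` may be exchanged
for `y` when the dual eigenvector of `y` does not vanish at `x` (`IsStarComplement.exchange`).

When `lam ^ 2 ≠ 1`, growing an edge gives a star complement without isolated vertices in the
induced subgraph (`exists_isStarComplement`). Such a set is a total dominating set, whence
`γ_t(G) ≤ n - m_G(lam)`. In the case of equality all these sets are minimum total dominating sets,
and `X` is chosen among them with the fewest induced edges (`IsTight`). A vertex `v` of `X` that is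
not adjacent to a leaf of the induced subgraph then has a private neighbour outside `X`, and the
dual eigenvectors of private neighbours have the entries `lam`, `0`, `-1` at such vertices. The row
of a leaf `v` at `u` gives the entry `lam ^ 2 - 1 ≠ 0` at `u`, and exchanging `u` for the private
neighbour of `v` lowers the number of edges unless `u` has another leaf
(`IsTight.exists_other_leaf`); two leaves at `u` force `lam ^ 2 + lam = 1` (`IsTight.two_leaves`).

* If `lam ^ 2 + lam ≠ 1`, the induced subgraph is a perfect matching (`IsTight.eq_of_adj`). The
  inverse of its block of `A - lam` is explicit (`IsTight.mate_equation`), and a vertex outside `X`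
  meets a single edge of the matching, since otherwise it could replace two vertices of `X`
  (`IsTight.eq_or_eq_mate`). This leaves `lam ^ 2 = 2`, `lam = 2` and `lam = 0`, with the star, the
  triangle and the complete bipartite graphs.
* If `lam ^ 2 + lam = 1`, the components of the induced subgraph are edges and paths on three
  vertices (`IsTight.component_cases`). Comparing rational and irrational parts, every vertex
  outside `X` has exactly one neighbour in `X`, an end of a path, and the graph is a five-cycle.

For the converse, `γ_t(G) ≤ n - m_G(lam)` is known, and it suffices to bound `m_G(lam)` from below.
-/

open Finset

namespace SimpleGraph

/-! ### Star complements and dual eigenvectors -/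

section StarComplement

variable {V : Type*} [Fintype V] [DecidableEq V] (G : SimpleGraph V) [DecidableRel G.Adj]

/-- The eigenspace of the adjacency matrix for `lam`. -/
abbrev adjEigenspace (lam : ℝ) : Submodule ℝ (V → ℝ) :=
  Module.End.eigenspace (Matrix.toLin' (G.adjMatrix ℝ)) lam

/-- A star complement for `lam`: no nonzero eigenvector is supported on `X`, and the complement
of `X` has as many vertices as the multiplicity of `lam`. Equivalently, the columns of `A - lam`
indexed by `X` form a basis of its column space. -/
structure IsStarComplement (lam : ℝ) (X : Finset V) : Prop where
  eq_zero : ∀ f ∈ G.adjEigenspace lam, (∀ v ∉ X, f v = 0) → f = 0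
  card_add : #X + G.adjMultiplicity lam = Fintype.card V

/-- The eigenvector which, off `X`, is the indicator of the vertex `y`. -/
structure IsDualEigenvector (lam : ℝ) (X : Finset V) (y : V) (f : V → ℝ) : Prop where
  mem : f ∈ G.adjEigenspace lam
  self : f y = 1
  off : ∀ v ∉ X, v ≠ y → f v = 0

variable {G} {lam : ℝ} {X : Finset V}

theorem mem_adjEigenspace_iff {f : V → ℝ} :
    f ∈ G.adjEigenspace lam ↔ ∀ v, ∑ u ∈ G.neighborFinset v, f u = lam * f v := by
  rw [Module.End.mem_eigenspace_iff, Matrix.toLin'_apply, funext_iff]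
  simp [adjMatrix_mulVec_apply]

/-- The restriction of eigenvectors to the complement of `X`. -/
noncomputable def restrictCompl (G : SimpleGraph V) [DecidableRel G.Adj] (lam : ℝ)
    (X : Finset V) : G.adjEigenspace lam →ₗ[ℝ] ({v // v ∉ X} → ℝ) :=
  (LinearMap.funLeft ℝ ℝ Subtype.val).comp (G.adjEigenspace lam).subtype

theorem card_compl_le_adjMultiplicity
    (h : ∀ y ∉ X, ∃ f, G.IsDualEigenvector lam X y f) :
    Fintype.card V ≤ #X + G.adjMultiplicity lam := by
  have hs : Function.Surjective (restrictCompl G lam X) := by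
    rw [← LinearMap.range_eq_top, eq_top_iff, ← (Pi.basisFun ℝ {v // v ∉ X}).span_eq,
      Submodule.span_le]
    rintro _ ⟨⟨y, hy⟩, rfl⟩
    obtain ⟨f, hf⟩ := h y hy
    refine ⟨⟨f, hf.mem⟩, ?_⟩
    ext ⟨v, hv⟩
    by_cases hvy : v = y
    · subst hvy
      simp [restrictCompl, LinearMap.funLeft_apply, hf.self]
    · simp [restrictCompl, LinearMap.funLeft_apply, hf.off v hv hvy, hvy]
  have h1 := LinearMap.finrank_le_finrank_of_surjective hs
  have h2 : Fintype.card {v // v ∉ X} = Fintype.card V - #X := by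
    rw [Fintype.card_subtype_compl]; simp
  rw [Module.finrank_fintype_fun_eq_card, h2] at h1
  have h3 : Module.finrank ℝ (G.adjEigenspace lam) = G.adjMultiplicity lam := rfl
  omega

theorem adjMultiplicity_le_card_compl
    (h : ∀ f ∈ G.adjEigenspace lam, (∀ v ∉ X, f v = 0) → f = 0) :
    #X + G.adjMultiplicity lam ≤ Fintype.card V := by
  have hi : Function.Injective (restrictCompl G lam X) := by
    rw [injective_iff_map_eq_zero]
    rintro ⟨f, hf⟩ h0
    have := h f hf fun v hv => congrFun h0 ⟨v, hv⟩
    simpa using this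
  have h1 := LinearMap.finrank_le_finrank_of_injective hi
  have h2 : Fintype.card {v // v ∉ X} = Fintype.card V - #X := by
    rw [Fintype.card_subtype_compl]; simp
  rw [Module.finrank_fintype_fun_eq_card, h2] at h1
  have h3 : Module.finrank ℝ (G.adjEigenspace lam) = G.adjMultiplicity lam := rfl
  have := Finset.card_le_univ X
  omega

theorem IsStarComplement.exists_dual (hX : G.IsStarComplement lam X) {y : V} (hy : y ∉ X) :
    ∃ f, G.IsDualEigenvector lam X y f := by
  have hi : Function.Injective (restrictCompl G lam X) := by
    rw [injective_iff_map_eq_zero]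
    rintro ⟨f, hf⟩ h0
    have := hX.eq_zero f hf fun v hv => congrFun h0 ⟨v, hv⟩
    simpa using this
  have h2 : Fintype.card {v // v ∉ X} = Fintype.card V - #X := by
    rw [Fintype.card_subtype_compl]; simp
  have h3 : Module.finrank ℝ (G.adjEigenspace lam) = Module.finrank ℝ ({v // v ∉ X} → ℝ) := by
    rw [Module.finrank_fintype_fun_eq_card, h2]
    have h4 : Module.finrank ℝ (G.adjEigenspace lam) = G.adjMultiplicity lam := rfl
    have := hX.card_add
    omega
  obtain ⟨⟨f, hf⟩, h⟩ :=
    (LinearMap.injective_iff_surjective_of_finrank_eq_finrank h3).1 hi (Pi.single ⟨y, hy⟩ 1)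
  refine ⟨f, hf, ?_, fun v hv hvy => ?_⟩
  · have := congrFun h ⟨y, hy⟩
    simpa [restrictCompl, LinearMap.funLeft_apply] using this
  · have := congrFun h ⟨v, hv⟩
    simpa [restrictCompl, LinearMap.funLeft_apply, hvy] using this

/-- The eigenvalue equation at the vertex `v` for the dual eigenvector of `y`. -/
theorem IsDualEigenvector.row {y : V} {f : V → ℝ} (hf : G.IsDualEigenvector lam X y f)
    (hy : y ∉ X) (v : V) :
    ∑ x ∈ X with G.Adj v x, f x + (if G.Adj v y then 1 else 0) = lam * f v := by
  rw [← mem_adjEigenspace_iff.1 hf.mem v]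
  have h1 : ∑ u ∈ G.neighborFinset v, f u = ∑ u ∈ insert y X, if G.Adj v u then f u else 0 := by
    rw [neighborFinset_eq_filter, sum_filter]
    symm
    refine sum_subset (subset_univ _) fun u _ hu => ?_
    simp only [mem_insert, not_or] at hu
    simp [hf.off u hu.2 hu.1]
  rw [h1, sum_insert hy, sum_filter, hf.self, add_comm]

/-- The exchange property of star complements. -/
theorem IsStarComplement.exchange (hX : G.IsStarComplement lam X) {x y : V} {f : V → ℝ}
    (hx : x ∈ X) (hy : y ∉ X) (hf : G.IsDualEigenvector lam X y f) (hfx : f x ≠ 0) :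
    G.IsStarComplement lam (insert y (X.erase x)) := by
  have hxy : x ≠ y := fun h => hy (h ▸ hx)
  refine ⟨fun g hg h0 => ?_, ?_⟩
  · have h1 : g - g y • f = 0 := by
      refine hX.eq_zero _ (Submodule.sub_mem _ hg (Submodule.smul_mem _ _ hf.mem)) fun v hv => ?_
      by_cases hvy : v = y
      · subst hvy
        simp [hf.self]
      · simp [hf.off v hv hvy, h0 v (by simp [hvy, hv])]
    have h2 : g x = 0 := h0 x (by simp [hxy])
    have h3 := congrFun h1 x
    have h4 : g y = 0 := by simpa [h2, hfx] using h3
    simpa [h4] using h1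
  · rw [card_insert_of_notMem (by simp [hy]), card_erase_add_one hx]
    exact hX.card_add

/-- A star complement dominates the other vertices, provided the graph has no isolated vertex. -/
theorem IsStarComplement.exists_adj (hX : G.IsStarComplement lam X)
    (hG : ∀ v, ∃ u, G.Adj v u) {y : V} (hy : y ∉ X) : ∃ x ∈ X, G.Adj y x := by
  by_contra! hno
  obtain ⟨f, hf⟩ := hX.exists_dual hy
  -- The part of `f` on `X` pairs to zero with every row of `A - lam` in `X`, and the dual
  -- eigenvectors, by symmetry of `A - lam`, show the same for the other rows.
  set g : V → ℝ := fun v => if v ∈ X then f v else 0 with hg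
  have hgX : ∀ x ∈ X, ∑ u ∈ G.neighborFinset x, g u = lam * g x := by
    intro x hx
    have h1 := hf.row hy x
    rw [if_neg (fun h => hno x hx h.symm), add_zero] at h1
    have h2 : g x = f x := by simp [hg, hx]
    rw [h2, ← h1, neighborFinset_eq_filter, sum_filter, sum_filter, ← sum_subset (subset_univ X)]
    · refine sum_congr rfl fun u hu => by simp [hg, hu]
    · intro u _ hu; simp [hg, hu]
  have hgE : g ∈ G.adjEigenspace lam := by
    rw [mem_adjEigenspace_iff]
    intro z
    by_cases hz : z ∈ X
    · exact hgX z hz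
    obtain ⟨k, hk⟩ := hX.exists_dual hz
    have hsym : ∑ v, k v * ∑ u ∈ G.neighborFinset v, g u
        = ∑ v, (∑ u ∈ G.neighborFinset v, k u) * g v := by
      simp only [neighborFinset_eq_filter, sum_filter, mul_sum, sum_mul]
      rw [sum_comm]
      refine sum_congr rfl fun u _ => sum_congr rfl fun v _ => ?_
      simp [G.adj_comm]
    have h3 : ∑ v, k v * (∑ u ∈ G.neighborFinset v, g u - lam * g v) = 0 := by
      simp only [mul_sub, sum_sub_distrib, hsym]
      rw [← sum_sub_distrib]
      refine sum_eq_zero fun v _ => ?_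
      rw [mem_adjEigenspace_iff.1 hk.mem v]; ring
    rw [sum_eq_single z] at h3
    · rw [hk.self] at h3; linarith
    · intro v _ hvz
      by_cases hv : v ∈ X
      · rw [hgX v hv]; ring
      · rw [hk.off v hv hvz]; ring
    · simp
  have hg0 := hX.eq_zero g hgE (fun v hv => by simp [hg, hv])
  have hf0 : ∀ v, v ≠ y → f v = 0 := by
    intro v hv
    by_cases hvX : v ∈ X
    · simpa [hg, hvX] using congrFun hg0 v
    · exact hf.off v hvX hv
  obtain ⟨u, hu⟩ := hG y
  have h1 := hf.row hy u
  rw [if_pos hu.symm, hf0 u hu.ne', sum_eq_zero] at h1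
  · norm_num at h1
  · intro x hx
    exact hf0 x (fun h => hy (h ▸ (mem_filter.1 hx).1))

/-- No vertex of `X` is isolated in the subgraph induced on `X`. -/
def NoIsolated (G : SimpleGraph V) (X : Finset V) : Prop := ∀ x ∈ X, ∃ z ∈ X, G.Adj x z

theorem IsStarComplement.isTotalDominatingSet (hX : G.IsStarComplement lam X)
    (hG : ∀ v, ∃ u, G.Adj v u) (hX' : G.NoIsolated X) : G.IsTotalDominatingSet X := by
  intro v
  by_cases hv : v ∈ X
  · exact hX' v hv
  · exact hX.exists_adj hG hv

theorem Connected.mem_of_closed {W : Type*} {H : SimpleGraph W} (hH : H.Connected) {T : Set W}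
    {a : W} (ha : a ∈ T) (hT : ∀ v ∈ T, ∀ u, H.Adj v u → u ∈ T) (v : W) : v ∈ T := by
  obtain ⟨p⟩ := hH.preconnected a v
  induction p with
  | nil => exact ha
  | cons h p ih => exact ih (hT _ ha _ h)

/-- A connected graph has a star complement that induces a subgraph without isolated vertices:
starting from an edge, which supports no eigenvector, any further growth inside the neighbourhood
stops only at a star complement. -/
theorem exists_isStarComplement (hG : G.Connected) (h1 : lam ^ 2 ≠ 1) {a b : V}
    (hab : G.Adj a b) : ∃ X, G.IsStarComplement lam X ∧ G.NoIsolated X := by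
  classical
  let P : Finset V → Prop := fun X => a ∈ X ∧ G.NoIsolated X ∧
    ∀ f ∈ G.adjEigenspace lam, (∀ v ∉ X, f v = 0) → f = 0
  have hP : P {a, b} := by
    refine ⟨by simp, ?_, fun f hf h0 => ?_⟩
    · intro x hx
      simp only [mem_insert, mem_singleton] at hx
      rcases hx with rfl | rfl
      · exact ⟨b, by simp, hab⟩
      · exact ⟨a, by simp, hab.symm⟩
    · have hrow : ∀ v w, (v = a ∧ w = b ∨ v = b ∧ w = a) → f w = lam * f v := by
        intro v w hvw
        rw [← mem_adjEigenspace_iff.1 hf v, sum_eq_single w]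
        · intro u hu huw
          rw [mem_neighborFinset] at hu
          apply h0
          have := hu.ne'
          rcases hvw with ⟨rfl, rfl⟩ | ⟨rfl, rfl⟩ <;> simp [huw, this]
        · intro h
          rw [mem_neighborFinset] at h
          rcases hvw with ⟨rfl, rfl⟩ | ⟨rfl, rfl⟩
          exacts [(h hab).elim, (h hab.symm).elim]
      have hb := hrow a b (Or.inl ⟨rfl, rfl⟩)
      have ha := hrow b a (Or.inr ⟨rfl, rfl⟩)
      have ha0 : f a = 0 := by
        have : (lam ^ 2 - 1) * f a = 0 := by rw [hb] at ha; linarith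
        rcases mul_eq_zero.1 this with h | h
        · exact absurd (by linarith) h1
        · exact h
      ext v
      by_cases hva : v = a
      · rw [hva, ha0]; rfl
      by_cases hvb : v = b
      · rw [hvb, hb, ha0]; simp
      · exact h0 v (by simp [hva, hvb])
  obtain ⟨X, hX, hmax⟩ := Finset.exists_max_image (univ.filter P) card ⟨_, by simpa using hP⟩
  simp only [mem_filter, mem_univ, true_and] at hX hmax
  obtain ⟨haX, hiso, hind⟩ := hX
  have hdual : ∀ y ∉ X, (∃ x ∈ X, G.Adj y x) → ∃ f, G.IsDualEigenvector lam X y f := by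
    rintro y hy ⟨x, hx, hyx⟩
    have hnot : ¬ P (insert y X) := by
      intro h
      have := hmax _ h
      rw [card_insert_of_notMem hy] at this
      omega
    have : ∃ f ∈ G.adjEigenspace lam, (∀ v ∉ insert y X, f v = 0) ∧ f ≠ 0 := by
      by_contra! hc
      refine hnot ⟨by simp [haX], ?_, hc⟩
      intro z hz
      rcases mem_insert.1 hz with rfl | hz
      · exact ⟨x, by simp [hx], hyx⟩
      · obtain ⟨t, ht, hzt⟩ := hiso z hz
        exact ⟨t, by simp [ht], hzt⟩
    obtain ⟨f, hf, hf0, hne⟩ := this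
    have hfy : f y ≠ 0 := by
      intro h
      refine hne (hind f hf fun v hv => ?_)
      by_cases hvy : v = y
      · rw [hvy, h]
      · exact hf0 v (by simp [hvy, hv])
    refine ⟨(f y)⁻¹ • f, Submodule.smul_mem _ _ hf, by simp [hfy], fun v hv hvy => ?_⟩
    simp [hf0 v (by simp [hvy, hv])]
  -- A vertex at distance two from `X` would violate the eigenvalue equation of a dual vector.
  have hdom : ∀ v, v ∈ {v | v ∈ X ∨ ∃ x ∈ X, G.Adj v x} := by
    refine hG.mem_of_closed (a := a) (Or.inl haX) ?_
    rintro v (hv | hv) u hvu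
    · exact Or.inr ⟨v, hv, hvu.symm⟩
    · by_cases hvX : v ∈ X
      · exact Or.inr ⟨v, hvX, hvu.symm⟩
      by_contra hu
      simp only [Set.mem_ofPred_eq, not_or, not_exists, not_and] at hu
      obtain ⟨f, hf⟩ := hdual v hvX hv
      have h2 := hf.row hvX u
      rw [if_pos hvu.symm, hf.off u hu.1 hvu.ne', filter_false_of_mem hu.2] at h2
      norm_num at h2
  refine ⟨X, ⟨hind, le_antisymm (adjMultiplicity_le_card_compl hind) ?_⟩, hiso⟩
  exact card_compl_le_adjMultiplicity fun y hy => hdual y hy ((hdom y).resolve_left hy)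

end StarComplement

/-! ### Leaves, private neighbours and degree sums -/

section DegreeSum

variable {V : Type*} [DecidableEq V] {G : SimpleGraph V} [DecidableRel G.Adj] {X : Finset V}

/-- The sum of the degrees in the subgraph induced on `X`. -/
def degSum {V : Type*} (G : SimpleGraph V) [DecidableRel G.Adj] (X : Finset V) : ℕ :=
  ∑ x ∈ X, #{z ∈ X | G.Adj x z}

theorem degSum_insert {y : V} {Z : Finset V} (hy : y ∉ Z) :
    G.degSum (insert y Z) = G.degSum Z + 2 * #{z ∈ Z | G.Adj y z} := by
  have h1 : ∀ x, #{z ∈ insert y Z | G.Adj x z}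
      = #{z ∈ Z | G.Adj x z} + if G.Adj y x then 1 else 0 := by
    intro x
    simp only [filter_insert, G.adj_comm y x]
    split_ifs with h
    · rw [card_insert_of_notMem (by simp [hy])]
    · simp
  rw [degSum, sum_insert hy]
  simp only [h1, sum_add_distrib, degSum, ← card_filter, SimpleGraph.irrefl, if_false]
  ring

theorem degSum_exchange {u y : V} (hu : u ∈ X) (hy : y ∉ X) :
    G.degSum (insert y (X.erase u)) + 2 * #{z ∈ X | G.Adj u z}
      = G.degSum X + 2 * #{z ∈ X.erase u | G.Adj y z} := by
  have h1 := degSum_insert (G := G) (y := y) (Z := X.erase u) (by simp [hy])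
  have h2 := degSum_insert (G := G) (y := u) (Z := X.erase u) (by simp)
  rw [insert_erase hu] at h2
  have h3 : #{z ∈ X.erase u | G.Adj u z} = #{z ∈ X | G.Adj u z} := by
    rw [filter_erase, erase_eq_of_notMem (by simp)]
  omega

end DegreeSum

section LeavesAndPrivateNeighbours

variable {V : Type*} {G : SimpleGraph V} {X : Finset V}

/-- In the subgraph induced on `X`, the vertex `v` is a leaf with neighbour `u`. -/
structure IsLeafAt (G : SimpleGraph V) (X : Finset V) (v u : V) : Prop where
  mem : v ∈ X
  mem_nbr : u ∈ X
  adj : G.Adj v u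
  eq : ∀ z ∈ X, G.Adj v z → z = u

/-- The vertex `w` lies outside `X` and `v` is its only neighbour in `X`. -/
structure IsPrivate (G : SimpleGraph V) (X : Finset V) (v w : V) : Prop where
  notMem : w ∉ X
  mem : v ∈ X
  adj : G.Adj w v
  eq : ∀ x ∈ X, G.Adj w x → x = v

/-- The vertex `v` of `X` is not adjacent to a leaf of the subgraph induced on `X`. -/
def IsFree (G : SimpleGraph V) (X : Finset V) (v : V) : Prop :=
  v ∈ X ∧ ∀ z ∈ X, G.Adj z v → ∃ t ∈ X, t ≠ v ∧ G.Adj z t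

theorem not_isFree {v : V} (hv : v ∈ X) (h : ¬ G.IsFree X v) : ∃ z, G.IsLeafAt X z v := by
  simp only [IsFree, hv, true_and] at h
  push Not at h
  obtain ⟨z, hz, hzv, h⟩ := h
  exact ⟨z, hz, hv, hzv, fun t ht hzt => by_contra fun hne => h t ht hne hzt⟩

theorem IsLeafAt.isFree {u v z : V} (h : G.IsLeafAt X v u) (hz : z ∈ X) (hzv : z ≠ v)
    (huz : G.Adj u z) : G.IsFree X v :=
  ⟨h.mem, fun _ ht htv => ⟨z, hz, hzv, (h.eq _ ht htv.symm) ▸ huz⟩⟩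

theorem IsPrivate.filter_adj [DecidableRel G.Adj] {v w : V} (hw : G.IsPrivate X v w) :
    ({x ∈ X | G.Adj w x} : Finset V) = {v} := by
  ext x
  simp only [mem_filter, mem_singleton]
  exact ⟨fun hx => hw.eq x hx.1 hx.2, by rintro rfl; exact ⟨hw.mem, hw.adj⟩⟩

theorem IsLeafAt.filter_adj [DecidableRel G.Adj] {u v : V} (h : G.IsLeafAt X v u) :
    ({x ∈ X | G.Adj v x} : Finset V) = {u} := by
  ext x
  simp only [mem_filter, mem_singleton]
  exact ⟨fun hx => h.eq x hx.1 hx.2, by rintro rfl; exact ⟨h.mem_nbr, h.adj⟩⟩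

end LeavesAndPrivateNeighbours

/-! ### Star complements with the fewest edges -/

section Tight

variable {V : Type*} [Fintype V] [DecidableEq V] {G : SimpleGraph V} [DecidableRel G.Adj]
  {lam : ℝ} {X : Finset V}

/-- A star complement without isolated vertices which is a smallest total dominating set, and
which induces the least possible number of edges among star complements without isolated vertices.
The graph itself has no isolated vertices either. -/
structure IsTight (G : SimpleGraph V) [DecidableRel G.Adj] (lam : ℝ) (X : Finset V) : Prop where
  star : G.IsStarComplement lam X
  noIsolated : G.NoIsolated X
  noIsolated_univ : ∀ v, ∃ u, G.Adj v u
  card_le : ∀ S, G.IsTotalDominatingSet S → #X ≤ #S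
  degSum_le : ∀ X', G.IsStarComplement lam X' → G.NoIsolated X' → G.degSum X ≤ G.degSum X'

theorem IsTight.of_degSum_le (h : G.IsTight lam X) {X' : Finset V}
    (h1 : G.IsStarComplement lam X') (h2 : G.NoIsolated X') (h3 : G.degSum X' ≤ G.degSum X) :
    G.IsTight lam X' where
  star := h1
  noIsolated := h2
  noIsolated_univ := h.noIsolated_univ
  card_le S hS := by
    have := h.card_le S hS
    have := h.star.card_add
    have := h1.card_add
    omega
  degSum_le X'' ha hb := h3.trans (h.degSum_le X'' ha hb)

/-- Deleting a free vertex creates no isolated vertex, so by minimality the vertex must be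
the only neighbour in `X` of some vertex outside `X`. -/
theorem IsTight.exists_private (h : G.IsTight lam X) {v : V} (hv : G.IsFree X v) :
    ∃ w, G.IsPrivate X v w := by
  have h1 : ¬ G.IsTotalDominatingSet (X.erase v) := by
    intro hS
    have h2 := h.card_le _ hS
    have h3 := card_erase_add_one hv.1
    omega
  simp only [IsTotalDominatingSet, not_forall, not_exists, not_and, mem_erase] at h1
  obtain ⟨t, ht⟩ := h1
  have h2 : ∀ x ∈ X, G.Adj t x → x = v := fun x hx htx => by_contra fun hne => ht x ⟨hne, hx⟩ htx
  have h3 : ∃ x ∈ X, G.Adj t x :=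
    h.star.isTotalDominatingSet h.noIsolated_univ h.noIsolated t
  obtain ⟨x, hx, htx⟩ := h3
  obtain rfl := h2 x hx htx
  refine ⟨t, fun htX => ?_, hx, htx, h2⟩
  obtain ⟨z, hz, hzx, htz⟩ := hv.2 t htX htx
  exact hzx (h2 z hz htz)

theorem IsPrivate.row {v w x : V} {f : V → ℝ} (hw : G.IsPrivate X v w)
    (hf : G.IsDualEigenvector lam X w f) (hx : x ∈ X) :
    ∑ z ∈ X with G.Adj x z, f z + (if x = v then 1 else 0) = lam * f x := by
  rw [← hf.row hw.notMem x]
  congr 2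
  exact propext ⟨fun h => h ▸ hw.adj.symm, fun h => hw.eq x hx h.symm⟩

theorem IsPrivate.dual_self {v w : V} {f : V → ℝ} (hw : G.IsPrivate X v w)
    (hf : G.IsDualEigenvector lam X w f) : f v = lam := by
  have h := hf.row hw.notMem w
  rw [hw.filter_adj, hf.self] at h
  simpa using h

theorem IsPrivate.dual_other {v w v' w' : V} {f : V → ℝ} (hw : G.IsPrivate X v w)
    (hf : G.IsDualEigenvector lam X w f) (hw' : G.IsPrivate X v' w') (hv : v' ≠ v) :
    f v' = if G.Adj w w' then -1 else 0 := by
  have hne : w' ≠ w := by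
    rintro rfl
    exact hv (hw.eq v' hw'.mem hw'.adj)
  have h := hf.row hw.notMem w'
  rw [hw'.filter_adj, hf.off w' hw'.notMem hne, sum_singleton] at h
  simp only [G.adj_comm w w']
  split_ifs at h ⊢ <;> linarith

theorem IsPrivate.dual_leaf {v w u : V} {f : V → ℝ} (hw : G.IsPrivate X v w)
    (hf : G.IsDualEigenvector lam X w f) (h : G.IsLeafAt X v u) : f u = lam ^ 2 - 1 := by
  have h1 := hw.row hf h.mem
  rw [h.filter_adj, hw.dual_self hf, sum_singleton, if_pos rfl] at h1
  linarith

/-- Two leaves with a common neighbour force `lam` to be a root of `x ^ 2 + x - 1`. -/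
theorem IsTight.two_leaves (h : G.IsTight lam X) (h1 : lam ^ 2 ≠ 1) {u v v' w w' : V}
    (hv : G.IsLeafAt X v u) (hv' : G.IsLeafAt X v' u) (hne : v' ≠ v) (hw : G.IsPrivate X v w)
    (hw' : G.IsPrivate X v' w') : lam ^ 2 + lam = 1 ∧ G.Adj w w' := by
  obtain ⟨f, hf⟩ := h.star.exists_dual hw.notMem
  have h2 := hw.row hf hv'.mem
  rw [hv'.filter_adj, sum_singleton, if_neg hne, hw.dual_leaf hf hv, hw.dual_other hf hw' hne]
    at h2
  split_ifs at h2 with hww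
  · exact ⟨by linarith, hww⟩
  · exact absurd (by linarith) h1

/-- If a vertex `u` of degree at least two in the induced subgraph had exactly one leaf `v`, then
exchanging `u` for the private neighbour of `v` would lower the number of edges. -/
theorem IsTight.exists_other_leaf (h : G.IsTight lam X) (h1 : lam ^ 2 ≠ 1) {u v z : V}
    (hv : G.IsLeafAt X v u) (hz : z ∈ X) (hzv : z ≠ v) (huz : G.Adj u z) :
    ∃ v', v' ≠ v ∧ G.IsLeafAt X v' u := by
  obtain ⟨w, hw⟩ := h.exists_private (hv.isFree hz hzv huz)
  obtain ⟨f, hf⟩ := h.star.exists_dual hw.notMem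
  by_contra! hno
  -- The entry of the dual eigenvector at `u` is `lam ^ 2 - 1`, so the exchange is possible.
  have hfu : f u ≠ 0 := by
    rw [hw.dual_leaf hf hv]
    exact sub_ne_zero.2 h1
  have hstar := h.star.exchange hv.mem_nbr hw.notMem hf hfu
  have hvu : v ≠ u := hv.adj.ne
  have hiso : G.NoIsolated (insert w (X.erase u)) := by
    intro x hx
    rcases mem_insert.1 hx with rfl | hx
    · exact ⟨v, by simp [hvu, hv.mem], hw.adj⟩
    · obtain ⟨hxu, hxX⟩ := mem_erase.1 hx
      by_cases hxv : x = v
      · exact ⟨w, by simp, hxv ▸ hw.adj.symm⟩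
      obtain ⟨t, ht, hxt⟩ := h.noIsolated x hxX
      by_cases htu : t = u
      · subst htu
        have h2 := hno x hxv
        by_contra! hc
        refine h2 ⟨hxX, ht, hxt, fun s hs hxs => by_contra fun hst => ?_⟩
        exact hc s (by simp [hst, hs]) hxs
      · exact ⟨t, by simp [htu, ht], hxt⟩
  have h2 := h.degSum_le _ hstar hiso
  have h3 := degSum_exchange (G := G) hv.mem_nbr hw.notMem
  have h4 : #{x ∈ X.erase u | G.Adj w x} ≤ 1 := by
    rw [← card_singleton v, ← hw.filter_adj]
    exact card_le_card (filter_subset_filter _ (erase_subset _ _))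
  have h5 : 1 < #{x ∈ X | G.Adj u x} :=
    one_lt_card.2 ⟨v, by simp [hv.mem, hv.adj.symm], z, by simp [hz, huz], hzv.symm⟩
  omega

/-- The eigenvalue equation at a vertex `v` for its own private neighbour: if all neighbours of
`v` are free, it reads `lam ^ 2 = 1 - k`, with `k` the number of neighbours of `v` whose private
neighbour is adjacent to that of `v`. -/
theorem IsTight.eq_zero_of_isFree (h : G.IsTight lam X) (h1 : lam ^ 2 ≠ 1) {v : V}
    (hv : G.IsFree X v) (hn : ∀ z ∈ X, G.Adj v z → G.IsFree X z) : lam = 0 := by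
  have hp : ∀ z, ∃ w, G.IsFree X z → G.IsPrivate X z w := fun z => by
    by_cases hz : G.IsFree X z
    · obtain ⟨w, hw⟩ := h.exists_private hz
      exact ⟨w, fun _ => hw⟩
    · exact ⟨z, fun hz' => absurd hz' hz⟩
  choose w hw using hp
  obtain ⟨f, hf⟩ := h.star.exists_dual (hw v hv).notMem
  have h2 := (hw v hv).row hf hv.1
  rw [(hw v hv).dual_self hf, if_pos rfl] at h2
  have h3 : ∑ z ∈ X with G.Adj v z, f z
      = -(#{z ∈ {z ∈ X | G.Adj v z} | G.Adj (w v) (w z)} : ℝ) := by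
    rw [card_filter, Nat.cast_sum, ← sum_neg_distrib]
    refine sum_congr rfl fun z hz => ?_
    rw [mem_filter] at hz
    rw [(hw v hv).dual_other hf (hw z (hn z hz.1 hz.2)) hz.2.ne']
    split_ifs <;> simp
  rw [h3] at h2
  set k := #{z ∈ {z ∈ X | G.Adj v z} | G.Adj (w v) (w z)}
  rcases Nat.lt_trichotomy k 1 with hk | hk | hk
  · rw [show k = 0 by omega] at h2
    norm_num at h2
    exact absurd (by linarith) h1
  · rw [hk] at h2
    have : lam * lam = 0 := by push_cast at h2; linarith
    simpa using this
  · have : (2 : ℝ) ≤ k := by exact_mod_cast hk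
    nlinarith [mul_self_nonneg lam]

/-- For `lam = 0`, the block of the inverse adjacency matrix of the induced subgraph that is indexed
by free vertices has entries `0` and `1`. A nonnegative matrix with nonnegative inverse is monomial;
the local form of this fact used here is that a vertex with only free vertices within distance two
has at most one neighbour. -/
theorem IsTight.eq_of_isFree_of_zero (h : G.IsTight 0 X) {v z₁ z₂ : V}
    (hv : G.IsFree X v) (hn : ∀ z ∈ X, G.Adj v z → G.IsFree X z)
    (hnn : ∀ z ∈ X, G.Adj v z → ∀ t ∈ X, G.Adj z t → G.IsFree X t)
    (hz₁ : z₁ ∈ X) (hvz₁ : G.Adj v z₁) (hz₂ : z₂ ∈ X) (hvz₂ : G.Adj v z₂) : z₁ = z₂ := by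
  by_contra hne
  have hp : ∀ z, ∃ w f, G.IsFree X z → G.IsPrivate X z w ∧ G.IsDualEigenvector 0 X w f :=
    fun z => by
    by_cases hz : G.IsFree X z
    · obtain ⟨w, hw⟩ := h.exists_private hz
      obtain ⟨f, hf⟩ := h.star.exists_dual hw.notMem
      exact ⟨w, f, fun _ => ⟨hw, hf⟩⟩
    · exact ⟨z, 0, fun hz' => absurd hz' hz⟩
  choose w f hwf using hp
  have hval : ∀ x, G.IsFree X x → ∀ z, G.IsFree X z →
      f x z = if G.Adj (w x) (w z) then -1 else 0 := by
    intro x hx z hz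
    by_cases hzx : z = x
    · subst hzx
      rw [(hwf z hz).1.dual_self (hwf z hz).2]
      simp
    · exact (hwf x hx).1.dual_other (hwf x hx).2 (hwf z hz).1 hzx
  have hnp : ∀ x, G.IsFree X x → ∀ z ∈ X, G.Adj v z → f x z ≤ 0 := by
    intro x hx z hz hvz
    rw [hval x hx z (hn z hz hvz)]
    split_ifs <;> norm_num
  have hrow : ∀ x, G.IsFree X x → ∀ y ∈ X,
      ∑ z ∈ X with G.Adj y z, f x z = if y = x then -1 else 0 := by
    intro x hx y hy
    have := (hwf x hx).1.row (hwf x hx).2 hy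
    rw [zero_mul] at this
    split_ifs at this ⊢ <;> linarith
  -- Away from the row of `v` itself, the row of `v` is a vanishing sum of nonpositive terms.
  have hother : ∀ x, G.IsFree X x → x ≠ v → ∀ z ∈ X, G.Adj v z → f x z = 0 := by
    intro x hx hxv z hz hvz
    have h1 := hrow x hx v hv.1
    rw [if_neg hxv.symm] at h1
    refine (sum_eq_zero_iff_of_nonpos fun t ht => ?_).1 h1 z (mem_filter.2 ⟨hz, hvz⟩)
    exact hnp x hx t (mem_filter.1 ht).1 (mem_filter.1 ht).2
  -- Were the private neighbours of `v` and `z` not adjacent, the dual vector of `z` would vanish on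
  -- all neighbours of `z`, against the row of `z`.
  have key : ∀ z ∈ X, G.Adj v z → f v z ≠ 0 := by
    intro z hz hvz h0
    have hzf := hn z hz hvz
    have h1 := hrow z hzf z hz
    rw [if_pos rfl, sum_eq_zero] at h1
    · norm_num at h1
    intro t ht
    rw [mem_filter] at ht
    have htf := hnn z hz hvz t ht.1 ht.2
    have hsymm : f z t = f t z := by
      rw [hval z hzf t htf, hval t htf z hzf]
      simp only [G.adj_comm]
    rw [hsymm]
    by_cases htv : t = v
    · rw [htv, h0]
    · exact hother t htf htv z hz hvz
  have hm : ∀ z ∈ X, G.Adj v z → f v z = -1 := by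
    intro z hz hvz
    have h1 := hval v hv z (hn z hz hvz)
    split_ifs at h1
    · exact h1
    · exact absurd h1 (key z hz hvz)
  have h1 := hrow v hv v hv.1
  rw [if_pos rfl, sum_congr rfl fun z hz => hm z (mem_filter.1 hz).1 (mem_filter.1 hz).2] at h1
  have h2 : 1 < #{x ∈ X | G.Adj v x} :=
    one_lt_card.2 ⟨z₁, by simp [hz₁, hvz₁], z₂, by simp [hz₂, hvz₂], hne⟩
  have h3 : (1 : ℝ) < #{x ∈ X | G.Adj v x} := by exact_mod_cast h2
  rw [sum_const, nsmul_eq_mul] at h1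
  linarith

/-- Unless `lam` is a root of `x ^ 2 + x - 1`, the induced subgraph is a perfect matching. -/
theorem IsTight.eq_of_adj (h : G.IsTight lam X) (h1 : lam ^ 2 ≠ 1) (h2 : lam ^ 2 + lam ≠ 1)
    {v z₁ z₂ : V} (hv : v ∈ X) (hz₁ : z₁ ∈ X) (hz₂ : z₂ ∈ X) (hvz₁ : G.Adj v z₁)
    (hvz₂ : G.Adj v z₂) : z₁ = z₂ := by
  by_contra hne
  -- A vertex with a leaf has no other neighbour, as it would carry two leaves.
  have hsupp : ∀ u ∈ X, ∀ v z, G.IsLeafAt X v u → z ∈ X → G.Adj u z → z = v := by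
    intro u hu v z hvu hz huz
    by_contra hzv
    obtain ⟨v', hv'v, hv'⟩ := h.exists_other_leaf h1 hvu hz hzv huz
    obtain ⟨w, hw⟩ := h.exists_private (hvu.isFree hz hzv huz)
    obtain ⟨w', hw'⟩ := h.exists_private (hv'.isFree hvu.mem hv'v.symm hvu.adj.symm)
    exact h2 (h.two_leaves h1 hvu hv' hv'v hw hw').1
  -- The vertices of degree at least two are therefore free, and so are their neighbours.
  let B : V → Prop := fun v => v ∈ X ∧ ∃ a ∈ X, ∃ b ∈ X, a ≠ b ∧ G.Adj v a ∧ G.Adj v b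
  have hBfree : ∀ v, B v → G.IsFree X v := by
    rintro v ⟨hv, a, ha, b, hb, hab, hva, hvb⟩
    by_contra hnf
    obtain ⟨z, hz⟩ := not_isFree hv hnf
    exact hab ((hsupp v hv z a hz ha hva).trans (hsupp v hv z b hz hb hvb).symm)
  have hBn : ∀ v, B v → ∀ z ∈ X, G.Adj v z → B z := by
    intro v hB z hz hvz
    obtain ⟨t, ht, htv, hzt⟩ := (hBfree v hB).2 z hz hvz.symm
    exact ⟨hz, t, ht, v, hB.1, htv, hzt, hvz.symm⟩
  have hBv : B v := ⟨hv, z₁, hz₁, z₂, hz₂, hne, hvz₁, hvz₂⟩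
  have hlam : lam = 0 :=
    h.eq_zero_of_isFree h1 (hBfree v hBv) fun z hz hvz => hBfree z (hBn v hBv z hz hvz)
  subst hlam
  exact hne (h.eq_of_isFree_of_zero (hBfree v hBv)
    (fun z hz hvz => hBfree z (hBn v hBv z hz hvz))
    (fun z hz hvz t ht hzt => hBfree t (hBn z (hBn v hBv z hz hvz) t ht hzt))
    hz₁ hvz₁ hz₂ hvz₂)

theorem TotalDominationEquality.exists_isTight (h : G.TotalDominationEquality lam)
    (hG : G.Connected) (h1 : lam ^ 2 ≠ 1) : ∃ X, G.IsTight lam X := by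
  classical
  have hS : ∃ S, G.IsTotalDominatingSet S := by
    by_contra hno
    have : IsEmpty {S : Finset V // G.IsTotalDominatingSet S} := ⟨fun S => hno ⟨S.1, S.2⟩⟩
    rw [TotalDominationEquality, totalDominationNumber, iInf_of_empty] at h
    exact ENat.top_ne_natCast _ h
  obtain ⟨S, hS⟩ := hS
  have hdeg : ∀ v, ∃ u, G.Adj v u := fun v => by
    obtain ⟨u, -, hu⟩ := hS v
    exact ⟨u, hu⟩
  obtain ⟨a⟩ := hG.nonempty
  obtain ⟨b, hab⟩ := hdeg a
  obtain ⟨X₀, hX₀⟩ := exists_isStarComplement hG h1 hab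
  obtain ⟨X, hX, hmin⟩ := Finset.exists_min_image
    (univ.filter fun X => G.IsStarComplement lam X ∧ G.NoIsolated X) G.degSum
    ⟨X₀, by simpa using hX₀⟩
  simp only [mem_filter, mem_univ, true_and] at hX hmin
  refine ⟨X, hX.1, hX.2, hdeg, fun S hS => ?_, fun X' h1 h2 => hmin X' ⟨h1, h2⟩⟩
  have h2 : G.totalDominationNumber ≤ #S :=
    iInf_le (fun S : {S : Finset V // G.IsTotalDominatingSet S} => (#S.1 : ℕ∞)) ⟨S, hS⟩
  rw [h] at h2
  have h3 := hX.1.card_add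
  have h4 : Fintype.card V - G.adjMultiplicity lam ≤ #S := by exact_mod_cast h2
  omega

/-- For `lam ^ 2 ≠ 1` the inequality `γ_t(G) ≤ n - m_G(lam)` holds, so only a lower bound for
total dominating sets is needed. -/
theorem totalDominationEquality_of_le (hG : G.Connected) (h1 : lam ^ 2 ≠ 1) {a b : V}
    (hab : G.Adj a b)
    (h : ∀ S, G.IsTotalDominatingSet S → Fintype.card V - G.adjMultiplicity lam ≤ #S) :
    G.TotalDominationEquality lam := by
  obtain ⟨X, hX, hiso⟩ := exists_isStarComplement hG h1 hab
  have hdeg : ∀ v, ∃ u, G.Adj v u := by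
    have : Nontrivial V := ⟨a, b, hab.ne⟩
    exact fun v => hG.preconnected.exists_adj_of_nontrivial v
  refine le_antisymm ?_ (le_iInf fun S => by exact_mod_cast h S.1 S.2)
  have h2 : G.totalDominationNumber ≤ #X :=
    iInf_le (fun S : {S : Finset V // G.IsTotalDominatingSet S} => (#S.1 : ℕ∞))
      ⟨X, hX.isTotalDominatingSet hdeg hiso⟩
  have h3 := hX.card_add
  rwa [show Fintype.card V - G.adjMultiplicity lam = #X by omega]

/-! ### The induced perfect matching -/

/-- Unless `lam ^ 2 + lam = 1`, each vertex of `X` is a leaf of the induced subgraph, at its mate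
`m x` in the perfect matching. -/
theorem IsTight.exists_mate (h : G.IsTight lam X) (h1 : lam ^ 2 ≠ 1) (h2 : lam ^ 2 + lam ≠ 1) :
    ∃ m : V → V, ∀ x ∈ X, G.IsLeafAt X x (m x) := by
  have : ∀ x, ∃ z, x ∈ X → G.IsLeafAt X x z := fun x => by
    by_cases hx : x ∈ X
    · obtain ⟨z, hz, hxz⟩ := h.noIsolated x hx
      exact ⟨z, fun _ => ⟨hx, hz, hxz, fun t ht hxt => h.eq_of_adj h1 h2 hx ht hz hxt hxz⟩⟩
    · exact ⟨x, fun h => absurd h hx⟩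
  choose m hm using this
  exact ⟨m, hm⟩

theorem mate_mate {V : Type*} {G : SimpleGraph V} {X : Finset V} {m : V → V}
    (hm : ∀ x ∈ X, G.IsLeafAt X x (m x)) {x : V} (hx : x ∈ X) : m (m x) = x :=
  ((hm (m x) (hm x hx).mem_nbr).eq x hx (hm x hx).adj.symm).symm

/-- The dual eigenvector of `y` on an edge of the matching, from the two rows of that edge. -/
theorem dual_of_mate {m : V → V} (hm : ∀ x ∈ X, G.IsLeafAt X x (m x)) {y : V} (hy : y ∉ X)
    {f : V → ℝ} (hf : G.IsDualEigenvector lam X y f) {x : V} (hx : x ∈ X) :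
    (lam ^ 2 - 1) * f x
      = lam * (if G.Adj y x then 1 else 0) + if G.Adj y (m x) then 1 else 0 := by
  have h1 := hf.row hy x
  have h2 := hf.row hy (m x)
  rw [(hm x hx).filter_adj, sum_singleton] at h1
  rw [(hm (m x) (hm x hx).mem_nbr).filter_adj, sum_singleton, mate_mate hm hx] at h2
  simp only [G.adj_comm y]
  linear_combination (-lam) * h1 - h2

/-- The inner product of two columns of `A - lam` outside the induced perfect matching `X`,
computed through the inverse of the block `X`. -/
theorem IsTight.mate_equation (h : G.IsTight lam X) {m : V → V}
    (hm : ∀ x ∈ X, G.IsLeafAt X x (m x)) {y y' : V} (hy : y ∉ X) (hy' : y' ∉ X) :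
    lam * #{x ∈ X | G.Adj y' x ∧ G.Adj y x} + #{x ∈ X | G.Adj y' x ∧ G.Adj y (m x)}
      + (lam ^ 2 - 1) * (if G.Adj y' y then 1 else 0)
      = lam * (lam ^ 2 - 1) * if y' = y then 1 else 0 := by
  obtain ⟨f, hf⟩ := h.star.exists_dual hy
  have h1 : f y' = if y' = y then 1 else 0 := by
    split_ifs with hyy
    · rw [hyy, hf.self]
    · exact hf.off y' hy' hyy
  have h2 : (lam ^ 2 - 1) * ∑ x ∈ X with G.Adj y' x, f x
      = lam * #{x ∈ X | G.Adj y' x ∧ G.Adj y x} + #{x ∈ X | G.Adj y' x ∧ G.Adj y (m x)} := by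
    rw [← filter_filter, ← filter_filter, card_filter, card_filter, mul_sum, Nat.cast_sum,
      Nat.cast_sum, mul_sum, ← sum_add_distrib]
    refine sum_congr rfl fun x hx => ?_
    rw [dual_of_mate hm hy hf (mem_filter.1 hx).1]
    push_cast
    rfl
  rw [← h2, ← h1]
  linear_combination (lam ^ 2 - 1) * hf.row hy y'

/-- If `y` met two edges of the induced perfect matching, then the far ends of these edges could
be replaced by `y`, giving a smaller total dominating set. -/
theorem IsTight.eq_or_eq_mate (h : G.IsTight lam X) {m : V → V}
    (hm : ∀ x ∈ X, G.IsLeafAt X x (m x)) (hd : ∀ i j : ℕ, lam * i + j = 0 → j = 0)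
    {y x₁ x₂ : V} (hy : y ∉ X) (hx₁ : x₁ ∈ X) (hx₂ : x₂ ∈ X) (hyx₁ : G.Adj y x₁)
    (hyx₂ : G.Adj y x₂) : x₂ = x₁ ∨ x₂ = m x₁ := by
  by_contra! hne
  obtain ⟨hne1, hne2⟩ := hne
  have hmm : m x₁ ≠ m x₂ := fun he => hne1 (by rw [← mate_mate hm hx₂, ← he, mate_mate hm hx₁])
  have hne3 : x₁ ≠ m x₂ := fun he => hne2 (by rw [he, mate_mate hm hx₂])
  have hne4 := (hm x₁ hx₁).adj.ne
  have hne5 := (hm x₂ hx₂).adj.ne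
  set Z := (X.erase (m x₁)).erase (m x₂) with hZ
  have hZmem : ∀ v, v ∈ Z ↔ v ≠ m x₂ ∧ v ≠ m x₁ ∧ v ∈ X := by simp [hZ]
  have hcard : #Z + 2 = #X := by
    have e1 := card_erase_add_one (hm x₁ hx₁).mem_nbr
    have e2 := card_erase_add_one (s := X.erase (m x₁)) (a := m x₂)
      (by simp [hmm.symm, (hm x₂ hx₂).mem_nbr])
    rw [← hZ] at e2
    omega
  have hS : G.IsTotalDominatingSet (insert y Z) := by
    intro t
    simp only [mem_insert, hZmem]
    by_cases ht : t ∈ X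
    · by_cases h1 : m t = m x₁
      · have : t = x₁ := by rw [← mate_mate hm ht, h1, mate_mate hm hx₁]
        exact ⟨y, Or.inl rfl, this ▸ hyx₁.symm⟩
      by_cases h2 : m t = m x₂
      · have : t = x₂ := by rw [← mate_mate hm ht, h2, mate_mate hm hx₂]
        exact ⟨y, Or.inl rfl, this ▸ hyx₂.symm⟩
      exact ⟨m t, Or.inr ⟨h2, h1, (hm t ht).mem_nbr⟩, (hm t ht).adj⟩
    by_cases hty : t = y
    · exact ⟨x₁, Or.inr ⟨hne3, hne4, hx₁⟩, hty ▸ hyx₁⟩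
    by_cases hadj : G.Adj t y
    · exact ⟨y, Or.inl rfl, hadj⟩
    obtain ⟨x, hx, htx⟩ := h.star.exists_adj h.noIsolated_univ ht
    -- If `t` met a deleted vertex `m xᵢ`, the crossing with `y` at `xᵢ` would make `t` and `y`
    -- adjacent.
    refine ⟨x, Or.inr ?_, htx⟩
    have h3 := h.mate_equation hm hy ht
    rw [if_neg hadj, if_neg hty, mul_zero, mul_zero, add_zero] at h3
    have h4 := card_eq_zero.1 (hd _ _ h3)
    have h5 : ¬ G.Adj y (m x) := fun h6 => by
      have : x ∈ ({x ∈ X | G.Adj t x ∧ G.Adj y (m x)} : Finset V) := by simp [hx, htx, h6]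
      rw [h4] at this
      simp at this
    refine ⟨?_, ?_, hx⟩ <;> rintro rfl
    · exact h5 (by rwa [mate_mate hm hx₂])
    · exact h5 (by rwa [mate_mate hm hx₁])
  have h1 := h.card_le _ hS
  rw [card_insert_of_notMem (by simp [hZmem, hy])] at h1
  omega

/-- A vertex `y` outside `X` has one or two neighbours in `X`, on a single edge of the matching, and
`IsTight.mate_equation` for `y` itself reads `lam = lam * (lam ^ 2 - 1)` in the first case and
`2 * (lam + 1) = lam * (lam ^ 2 - 1)` in the second. -/
theorem IsTight.self_equation (h : G.IsTight lam X) (h1 : lam ^ 2 ≠ 1) {m : V → V}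
    (hm : ∀ x ∈ X, G.IsLeafAt X x (m x)) (hd : ∀ i j : ℕ, lam * i + j = 0 → j = 0)
    {y x : V} (hy : y ∉ X) (hx : x ∈ X) (hyx : G.Adj y x) :
    (¬ G.Adj y (m x) ∧ lam * (lam ^ 2 - 2) = 0) ∨ (G.Adj y (m x) ∧ lam = 2) := by
  have hne := (hm x hx).adj.ne
  have hmx := (hm x hx).mem_nbr
  have hs : ∀ z ∈ X, G.Adj y z → z = x ∨ z = m x := fun z hz hyz =>
    h.eq_or_eq_mate hm hd hy hx hz hyx hyz
  have h3 := h.mate_equation hm hy hy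
  rw [if_neg (by simp), if_pos rfl] at h3
  by_cases hymx : G.Adj y (m x)
  · have e1 : ({z ∈ X | G.Adj y z ∧ G.Adj y z} : Finset V) = {x, m x} := by
      ext z
      simp only [mem_filter, and_self, mem_insert, mem_singleton]
      exact ⟨fun hz => hs z hz.1 hz.2, by rintro (rfl | rfl) <;> simp [*]⟩
    have e2 : ({z ∈ X | G.Adj y z ∧ G.Adj y (m z)} : Finset V) = {x, m x} := by
      ext z
      simp only [mem_filter, mem_insert, mem_singleton]
      exact ⟨fun hz => hs z hz.1 hz.2.1, by
        rintro (rfl | rfl) <;> simp [*, mate_mate hm hx]⟩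
    rw [e1, e2, card_pair hne] at h3
    have h4 : (lam + 1) * ((lam + 1) * (lam - 2)) = 0 := by
      push_cast at h3; linear_combination -h3
    have h5 : lam + 1 ≠ 0 := fun h6 => h1 (by rw [show lam = -1 by linarith]; norm_num)
    simp only [mul_eq_zero, h5, false_or] at h4
    exact Or.inr ⟨hymx, by linarith⟩
  · have e1 : ({z ∈ X | G.Adj y z ∧ G.Adj y z} : Finset V) = {x} := by
      ext z
      simp only [mem_filter, and_self, mem_singleton]
      refine ⟨fun hz => (hs z hz.1 hz.2).resolve_right fun h6 => hymx (h6 ▸ hz.2), ?_⟩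
      rintro rfl
      exact ⟨hx, hyx⟩
    have e2 : ({z ∈ X | G.Adj y z ∧ G.Adj y (m z)} : Finset V) = ∅ := by
      refine filter_false_of_mem fun z hz hyz => ?_
      rcases hs z hz hyz.1 with rfl | rfl
      · exact hymx hyz.2
      · exact hymx hyz.1
    rw [e1, e2, card_singleton, card_empty] at h3
    push_cast at h3
    exact Or.inl ⟨hymx, by linear_combination -h3⟩

/-- The condition `hdis` on `lam` says that `IsTight.mate_equation` for two distinct vertices
outside `X` has only the trivial solution: they are not adjacent and do not meet the same edge. By
connectedness there is then only one such vertex and only one edge. -/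
theorem IsTight.eq_of_disjoint (h : G.IsTight lam X) (hG : G.Connected) {m : V → V}
    (hm : ∀ x ∈ X, G.IsLeafAt X x (m x)) (hd : ∀ i j : ℕ, lam * i + j = 0 → j = 0)
    (hdis : ∀ i j a : ℕ, a ≤ 1 → lam * i + j + (lam ^ 2 - 1) * a = 0 → i = 0 ∧ j = 0 ∧ a = 0)
    {x y : V} (hy : y ∉ X) (hx : x ∈ X) (hyx : G.Adj y x) (v : V) :
    v = x ∨ v = m x ∨ v = y := by
  have key : ∀ y' ∉ X, y' ≠ y → ¬ G.Adj y' y ∧ ¬ G.Adj y' x ∧ ¬ G.Adj y' (m x) := by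
    intro y' hy' hne
    have h3 := h.mate_equation hm hy hy'
    rw [if_neg hne, mul_zero] at h3
    have h4 := hdis _ _ (if G.Adj y' y then 1 else 0) (by split_ifs <;> simp)
      (by simpa using h3)
    refine ⟨fun h5 => by simp [h5] at h4, fun h5 => ?_, fun h5 => ?_⟩
    · have := filter_eq_empty_iff.1 (card_eq_zero.1 h4.1) hx
      exact this ⟨h5, hyx⟩
    · have := filter_eq_empty_iff.1 (card_eq_zero.1 h4.2.1) (hm x hx).mem_nbr
      exact this ⟨h5, by rwa [mate_mate hm hx]⟩
  refine hG.mem_of_closed (T := {v | v = x ∨ v = m x ∨ v = y}) (a := x) (Or.inl rfl) ?_ v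
  have hmx := (hm x hx).mem_nbr
  rintro v (rfl | rfl | rfl) u hvu <;> by_cases hu : u ∈ X
  · exact Or.inr (Or.inl ((hm _ hx).eq u hu hvu))
  · exact Or.inr (Or.inr (by_contra fun hne => (key u hu hne).2.1 hvu.symm))
  · refine Or.inl ?_
    rw [(hm _ hmx).eq u hu hvu, mate_mate hm hx]
  · exact Or.inr (Or.inr (by_contra fun hne => (key u hu hne).2.2 hvu.symm))
  · rcases h.eq_or_eq_mate hm hd hy hx hu hyx hvu with h | h
    · exact Or.inl h
    · exact Or.inr (Or.inl h)
  · exact Or.inr (Or.inr (by_contra fun hne => (key u hu hne).1 hvu.symm))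

theorem IsAdjEigenvalue.adjMultiplicity_pos (hlam : G.IsAdjEigenvalue lam) :
    0 < G.adjMultiplicity lam := by
  rw [adjMultiplicity, Module.finrank_pos_iff, Submodule.nontrivial_iff_ne_bot]
  exact hlam

theorem IsStarComplement.exists_notMem (hX : G.IsStarComplement lam X)
    (hlam : G.IsAdjEigenvalue lam) : ∃ y, y ∉ X := by
  by_contra! hall
  have h1 := hX.card_add
  have h2 := hlam.adjMultiplicity_pos
  have h3 : #X = Fintype.card V := by
    rw [Finset.eq_univ_of_forall hall, card_univ]
  omega

/-! ### Roots of `x ^ 2 + x - 1` -/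

/-- The path `v - u - v'` is a connected component of the subgraph induced on `X`. -/
structure IsPathComponent {V : Type*} (G : SimpleGraph V) (X : Finset V) (v u v' : V) : Prop where
  ne : v ≠ v'
  left : G.IsLeafAt X v u
  right : G.IsLeafAt X v' u
  center : ∀ z ∈ X, G.Adj u z → z = v ∨ z = v'

theorem IsPathComponent.swap {V : Type*} {G : SimpleGraph V} {X : Finset V} {v u v' : V}
    (h : G.IsPathComponent X v u v') : G.IsPathComponent X v' u v :=
  ⟨h.ne.symm, h.right, h.left, fun z hz huz => (h.center z hz huz).symm⟩

theorem IsPathComponent.isFree {V : Type*} {G : SimpleGraph V} {X : Finset V} {v u v' : V}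
    (h : G.IsPathComponent X v u v') : G.IsFree X v :=
  h.left.isFree h.right.mem h.ne.symm h.right.adj.symm

theorem IsPathComponent.filter_adj {V : Type*} [DecidableEq V] {G : SimpleGraph V}
    [DecidableRel G.Adj] {X : Finset V} {v u v' : V} (h : G.IsPathComponent X v u v') :
    ({x ∈ X | G.Adj u x} : Finset V) = {v, v'} := by
  ext x
  simp only [mem_filter, mem_insert, mem_singleton]
  refine ⟨fun hx => h.center x hx.1 hx.2, ?_⟩
  rintro (rfl | rfl)
  exacts [⟨h.left.mem, h.left.adj.symm⟩, ⟨h.right.mem, h.right.adj.symm⟩]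

/-- The centre of a path component is not a leaf. -/
theorem IsPathComponent.not_isLeafAt {V : Type*} {G : SimpleGraph V} {X : Finset V}
    {v u v' t : V} (h : G.IsPathComponent X v u v') : ¬ G.IsLeafAt X u t := fun hl =>
  h.ne ((hl.eq v h.left.mem h.left.adj.symm).trans (hl.eq v' h.right.mem h.right.adj.symm).symm)

/-- A vertex `u` with a leaf and another neighbour is the centre of a path component. There is a
second leaf at `u`; with a third neighbour, exchanging the second leaf for the private neighbour
`w` of the first one, `v`, would give an equally good star complement in which `v` has the single
leaf `w` and the other neighbour `u`, against `IsTight.exists_other_leaf`. -/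
theorem IsTight.exists_isPathComponent (h : G.IsTight lam X) (h1 : lam ^ 2 ≠ 1) {u v z : V}
    (hv : G.IsLeafAt X v u) (hz : z ∈ X) (hzv : z ≠ v) (huz : G.Adj u z) :
    ∃ v', G.IsPathComponent X v u v' := by
  obtain ⟨v', hne, hv'⟩ := h.exists_other_leaf h1 hv hz hzv huz
  refine ⟨v', hne.symm, hv, hv', fun t ht hut => ?_⟩
  by_contra! htn
  obtain ⟨w, hw⟩ := h.exists_private (hv.isFree hz hzv huz)
  obtain ⟨w', hw'⟩ := h.exists_private (hv'.isFree hv.mem hne.symm hv.adj.symm)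
  have hww := (h.two_leaves h1 hv hv' hne hw hw').2
  obtain ⟨f, hf⟩ := h.star.exists_dual hw.notMem
  have hfv : f v' ≠ 0 := by
    rw [hw.dual_other hf hw' hne, if_pos hww]
    norm_num
  have hstar := h.star.exchange hv'.mem hw.notMem hf hfv
  have hvX : v ∈ insert w (X.erase v') := by simp [hne.symm, hv.mem]
  have huX : u ∈ insert w (X.erase v') := by simp [hv'.adj.ne', hv.mem_nbr]
  have htX : t ∈ insert w (X.erase v') := by simp [htn.2, ht]
  have hiso : G.NoIsolated (insert w (X.erase v')) := by
    intro x hx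
    rcases mem_insert.1 hx with rfl | hx
    · exact ⟨v, hvX, hw.adj⟩
    · obtain ⟨-, hxX⟩ := mem_erase.1 hx
      obtain ⟨s, hs, hxs⟩ := h.noIsolated x hxX
      by_cases hsv : s = v'
      · subst hsv
        obtain rfl := hv'.eq x hxX hxs.symm
        exact ⟨v, hvX, hv.adj.symm⟩
      · exact ⟨s, by simp [hsv, hs], hxs⟩
  have hdeg : G.degSum (insert w (X.erase v')) ≤ G.degSum X := by
    have h3 := degSum_exchange (G := G) hv'.mem hw.notMem
    have h4 : #{x ∈ X.erase v' | G.Adj w x} ≤ 1 := by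
      rw [← card_singleton v, ← hw.filter_adj]
      exact card_le_card (filter_subset_filter _ (erase_subset _ _))
    rw [hv'.filter_adj, card_singleton] at h3
    omega
  have h' := h.of_degSum_le hstar hiso hdeg
  have hleaf : G.IsLeafAt (insert w (X.erase v')) w v := by
    refine ⟨by simp, hvX, hw.adj, fun s hs hws => ?_⟩
    rcases mem_insert.1 hs with rfl | hs
    · exact absurd hws (G.irrefl)
    · exact hw.eq s (mem_erase.1 hs).2 hws
  have huw : u ≠ w := fun he => hw.notMem (he ▸ hv.mem_nbr)
  obtain ⟨s, hsw, hs⟩ := h'.exists_other_leaf h1 hleaf huX huw hv.adj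
  have hsX : s ∈ X := by
    rcases mem_insert.1 hs.mem with rfl | h5
    · exact absurd rfl hsw
    · exact (mem_erase.1 h5).2
  obtain rfl := hv.eq s hsX hs.adj.symm
  exact htn.1 (hs.eq t htX hut)

/-- For a root `lam` of `x ^ 2 + x - 1`, every component of the induced subgraph is an edge or
a path with three vertices. -/
theorem IsTight.component_cases (h : G.IsTight lam X) (h1 : lam ^ 2 ≠ 1) (h0 : lam ≠ 0) {x : V}
    (hx : x ∈ X) : (∃ t, G.IsLeafAt X x t ∧ G.IsLeafAt X t x) ∨
      (∃ u v', G.IsPathComponent X x u v') ∨ ∃ v v', G.IsPathComponent X v x v' := by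
  obtain ⟨t, ht, hxt⟩ := h.noIsolated x hx
  by_cases hxl : ∃ t, G.IsLeafAt X x t
  · obtain ⟨t, hxt⟩ := hxl
    by_cases htl : ∀ z ∈ X, G.Adj t z → z = x
    · exact Or.inl ⟨t, hxt, hxt.mem_nbr, hx, hxt.adj.symm, htl⟩
    · push Not at htl
      obtain ⟨z, hz, htz, hzx⟩ := htl
      exact Or.inr (Or.inl ⟨t, h.exists_isPathComponent h1 hxt hz hzx htz⟩)
  have hsecond : ∀ s, ∃ z ∈ X, z ≠ s ∧ G.Adj x z := by
    intro s
    by_contra! hc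
    refine hxl ⟨t, hx, ht, hxt, fun z hz hxz => ?_⟩
    rw [by_contra fun hzs => hc z hz hzs hxz, by_contra fun hts => hc t ht hts hxt]
  refine Or.inr (Or.inr ?_)
  by_cases hfree : G.IsFree X x
  · refine absurd (h.eq_zero_of_isFree h1 hfree fun z hz hxz => ?_) h0
    by_contra hnf
    obtain ⟨l, hl⟩ := not_isFree hz hnf
    have hxl' : x ≠ l := fun he => hxl ⟨z, he ▸ hl⟩
    obtain ⟨v', hp⟩ := h.exists_isPathComponent h1 hl hx hxl' hxz.symm
    rcases hp.center x hx hxz.symm with rfl | rfl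
    · exact hxl' rfl
    · exact hxl ⟨z, hp.right⟩
  · obtain ⟨l, hl⟩ := not_isFree hx hfree
    obtain ⟨z, hz, hzl, hxz⟩ := hsecond l
    exact ⟨l, h.exists_isPathComponent h1 hl hz hzl hxz⟩

/-- The entry of the dual eigenvector of `y` at a neighbour `x` of `y`, split along the basis
`1, lam` of the quadratic field. The rational part has a sign, and it vanishes only at the end of a
path component. -/
theorem IsTight.dual_golden (h : G.IsTight lam X) (hl : lam ^ 2 + lam = 1) (h1 : lam ^ 2 ≠ 1)
    (h0 : lam ≠ 0) {y x : V} {f : V → ℝ} (hy : y ∉ X) (hf : G.IsDualEigenvector lam X y f)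
    (hx : x ∈ X) (hyx : G.Adj y x) :
    ∃ (ρ : ℕ) (σ : ℤ), f x = -(ρ + σ * lam) ∧
      (ρ = 0 → ∃ u v', G.IsPathComponent X x u v' ∧ (¬ G.Adj y u → σ = -1)) := by
  rcases h.component_cases h1 h0 hx with ⟨t, hxt, htx⟩ | ⟨u, v', hp⟩ | ⟨v, v', hp⟩
  · have r1 := hf.row hy x
    have r2 := hf.row hy t
    rw [hxt.filter_adj, sum_singleton, if_pos hyx.symm] at r1
    rw [htx.filter_adj, sum_singleton] at r2
    refine ⟨1 + (if G.Adj t y then 1 else 0), if G.Adj t y then 1 else 0, ?_, by simp⟩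
    push_cast
    linear_combination (1 + lam) * (lam * r1 + r2) + (lam * f x - 1) * hl
  · have r1 := hf.row hy x
    have r2 := hf.row hy u
    have r3 := hf.row hy v'
    rw [hp.left.filter_adj, sum_singleton, if_pos hyx.symm] at r1
    rw [hp.filter_adj, sum_pair hp.ne] at r2
    rw [hp.right.filter_adj, sum_singleton] at r3
    refine ⟨if G.Adj v' y then 1 else 0, (if G.Adj u y then 1 else 0) - 1, ?_, fun _ =>
      ⟨u, v', hp, fun hn => by rw [if_neg fun h => hn h.symm]; rfl⟩⟩
    push_cast
    linear_combination -lam * r1 + lam * r2 + r3 + (f u - f x) * hl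
  · have r1 := hf.row hy v
    have r2 := hf.row hy x
    have r3 := hf.row hy v'
    rw [hp.left.filter_adj, sum_singleton] at r1
    rw [hp.filter_adj, sum_pair hp.ne, if_pos hyx.symm] at r2
    rw [hp.right.filter_adj, sum_singleton] at r3
    refine ⟨1, (if G.Adj v y then 1 else 0) + (if G.Adj v' y then 1 else 0) - 1, ?_, by simp⟩
    push_cast
    linear_combination lam * r1 + lam ^ 2 * r2 + lam * r3 - (f x * (1 - lam) + 1) * hl

/-- The row of `y` equates the sum of the entries in `IsTight.dual_golden` to `lam`: the rational
parts must all vanish, and the coefficients of `lam` count the neighbours of `y`. -/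
theorem IsTight.exists_private_golden (h : G.IsTight lam X) (hl : lam ^ 2 + lam = 1)
    (hirr : Irrational lam) (h1 : lam ^ 2 ≠ 1) (h0 : lam ≠ 0) {y : V} (hy : y ∉ X) :
    ∃ x u v', G.IsPathComponent X x u v' ∧ G.IsPrivate X x y := by
  obtain ⟨f, hf⟩ := h.star.exists_dual hy
  have hex : ∀ x, ∃ (ρ : ℕ) (σ : ℤ), x ∈ X → G.Adj y x → f x = -(ρ + σ * lam) ∧
      (ρ = 0 → ∃ u v', G.IsPathComponent X x u v' ∧ (¬ G.Adj y u → σ = -1)) := fun x => by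
    by_cases hx : x ∈ X
    · by_cases hyx : G.Adj y x
      · obtain ⟨ρ, σ, h3⟩ := h.dual_golden hl h1 h0 hy hf hx hyx
        exact ⟨ρ, σ, fun _ _ => h3⟩
      · exact ⟨0, 0, fun _ h => absurd h hyx⟩
    · exact ⟨0, 0, fun h => absurd h hx⟩
  choose ρ σ hρσ using hex
  have hrow := hf.row hy y
  rw [if_neg (by simp), add_zero, hf.self, mul_one] at hrow
  have hsum : ∑ x ∈ X with G.Adj y x, f x = -((∑ x ∈ X with G.Adj y x, ρ x : ℕ) +
      (∑ x ∈ X with G.Adj y x, σ x : ℤ) * lam) := by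
    push_cast
    rw [sum_mul, ← sum_add_distrib, ← sum_neg_distrib]
    exact sum_congr rfl fun x hx => (hρσ x (mem_filter.1 hx).1 (mem_filter.1 hx).2).1
  rw [hrow] at hsum
  set P := ∑ x ∈ X with G.Adj y x, ρ x with hP
  set Q := ∑ x ∈ X with G.Adj y x, σ x with hQ
  have hQ1 : Q = -1 := by
    by_contra hne
    have hne' : ((Q : ℝ) + 1) ≠ 0 := fun h => hne (by
      have : ((Q + 1 : ℤ) : ℝ) = 0 := by push_cast; exact h
      have := Int.cast_eq_zero.1 this
      omega)
    refine hirr ⟨-P / (Q + 1), ?_⟩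
    push_cast
    rw [div_eq_iff hne']
    linear_combination -hsum
  have hP0 : P = 0 := by
    rw [hQ1] at hsum
    push_cast at hsum
    have : (P : ℝ) = 0 := by linear_combination hsum
    exact_mod_cast this
  have hρ0 : ∀ x ∈ X, G.Adj y x → ρ x = 0 := fun x hx hyx =>
    (sum_eq_zero_iff.1 hP0) x (mem_filter.2 ⟨hx, hyx⟩)
  have hcomp : ∀ x ∈ X, G.Adj y x → ∃ u v', G.IsPathComponent X x u v' ∧ σ x = -1 := by
    intro x hx hyx
    obtain ⟨u, v', hp, hσ⟩ := (hρσ x hx hyx).2 (hρ0 x hx hyx)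
    refine ⟨u, v', hp, hσ fun hyu => ?_⟩
    obtain ⟨u', v'', hp', -⟩ := (hρσ u hp.left.mem_nbr hyu).2 (hρ0 u hp.left.mem_nbr hyu)
    exact hp.not_isLeafAt hp'.left
  have hcard : #{x ∈ X | G.Adj y x} = 1 := by
    have hσ : ∀ x ∈ ({x ∈ X | G.Adj y x} : Finset V), σ x = -1 := fun x hx => by
      obtain ⟨-, -, -, hσ⟩ := hcomp x (mem_filter.1 hx).1 (mem_filter.1 hx).2
      exact hσ
    rw [hQ, sum_congr rfl hσ] at hQ1
    simpa using hQ1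
  obtain ⟨x, hx⟩ := card_eq_one.1 hcard
  have hmem : ∀ z, z ∈ X ∧ G.Adj y z ↔ z = x := fun z => by
    rw [← mem_filter, hx, mem_singleton]
  obtain ⟨hxX, hyx⟩ := (hmem x).2 rfl
  obtain ⟨u, v', hp, -⟩ := hcomp x hxX hyx
  exact ⟨x, u, v', hp, hy, hxX, hyx, fun z hz hyz => (hmem z).1 ⟨hz, hyz⟩⟩

theorem IsTight.private_unique (h : G.IsTight lam X) (hirr : Irrational lam) {v w w' : V}
    (hw : G.IsPrivate X v w) (hw' : G.IsPrivate X v w') : w' = w := by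
  by_contra hne
  obtain ⟨f, hf⟩ := h.star.exists_dual hw.notMem
  have hr := hf.row hw.notMem w'
  rw [hw'.filter_adj, sum_singleton, hw.dual_self hf, hf.off w' hw'.notMem hne, mul_zero] at hr
  split_ifs at hr
  · exact hirr ⟨-1, by push_cast; linarith⟩
  · exact hirr ⟨0, by push_cast; linarith⟩

/-- The dual eigenvector of `w` vanishes on the path components other than that of `v`, so
`w` has at most one neighbour outside `X`, the private neighbour of the other end of the path. -/
theorem IsTight.eq_of_private_golden (h : G.IsTight lam X) (hl : lam ^ 2 + lam = 1)
    (hirr : Irrational lam) (h1 : lam ^ 2 ≠ 1) (h0 : lam ≠ 0) {v u v' w w' y : V}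
    (hp : G.IsPathComponent X v u v') (hw : G.IsPrivate X v w) (hw' : G.IsPrivate X v' w')
    (hy : y ∉ X) (hwy : G.Adj w y) : y = w' := by
  obtain ⟨x, s, x', hq, hx⟩ := h.exists_private_golden hl hirr h1 h0 hy
  have hxv : x ≠ v := by
    rintro rfl
    exact hwy.ne (h.private_unique hirr hx hw)
  by_cases hxv' : x = v'
  · subst hxv'
    exact (h.private_unique hirr hx hw').symm
  exfalso
  obtain ⟨f, hf⟩ := h.star.exists_dual hw.notMem
  have e0 := hw.dual_other hf hx hxv
  rw [if_pos hwy] at e0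
  have hsu : s ≠ u := by
    rintro rfl
    rcases hp.center x hq.left.mem hq.left.adj.symm with h | h
    exacts [hxv h, hxv' h]
  have hsv : s ≠ v := by
    rintro rfl
    exact hq.not_isLeafAt hp.left
  have hx'v : x' ≠ v := by
    rintro rfl
    exact hsu (hp.left.eq s hq.right.mem_nbr hq.right.adj)
  have r1 := hw.row hf hq.left.mem
  have r2 := hw.row hf hq.left.mem_nbr
  have r3 := hw.row hf hq.right.mem
  rw [hq.left.filter_adj, sum_singleton, if_neg hxv, e0] at r1
  rw [hq.filter_adj, sum_pair hq.ne, if_neg hsv, e0] at r2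
  rw [hq.right.filter_adj, sum_singleton, if_neg hx'v] at r3
  have e1 : f x' = -1 := by
    have : lam * (f x' + 1) = 0 := by linear_combination r1 - r3
    rcases mul_eq_zero.1 this with h | h
    · exact absurd h h0
    · linarith
  have e2 : lam ^ 2 = 2 := by rw [e1] at r2; linear_combination lam * r1 + r2
  have e3 : lam = -1 := by linarith
  rw [e3] at e2
  norm_num at e2

theorem nonempty_iso_of_bijective {V W : Type*} {G : SimpleGraph V} {H : SimpleGraph W}
    (φ : W → V) (hφ : Function.Bijective φ) (hadj : ∀ i j, G.Adj (φ i) (φ j) ↔ H.Adj i j) :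
    Nonempty (G ≃g H) :=
  ⟨(⟨Equiv.ofBijective φ hφ, fun {i j} => hadj i j⟩ : H ≃g G).symm⟩

theorem IsTight.iso_cycleGraph (h : G.IsTight lam X) (hG : G.Connected)
    (hlam : G.IsAdjEigenvalue lam) (hl : lam ^ 2 + lam = 1) (hirr : Irrational lam) :
    Nonempty (G ≃g cycleGraph 5) := by
  have h0 : lam ≠ 0 := hirr.ne_zero
  have h1 : lam ^ 2 ≠ 1 := fun h => h0 (by linarith)
  obtain ⟨w, hwX⟩ := h.star.exists_notMem hlam
  obtain ⟨v, u, v', hp, hw⟩ := h.exists_private_golden hl hirr h1 h0 hwX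
  obtain ⟨w', hw'⟩ := h.exists_private hp.swap.isFree
  have hww := (h.two_leaves h1 hp.left hp.right hp.ne.symm hw hw').2
  have hprivu : ∀ y ∉ X, ¬ G.Adj u y := by
    intro y hy huy
    obtain ⟨x, s, x', hq, hx⟩ := h.exists_private_golden hl hirr h1 h0 hy
    exact hp.not_isLeafAt ((hx.eq u hp.left.mem_nbr huy.symm) ▸ hq.left)
  have hend : ∀ x s x' z, G.IsPathComponent X x s x' → G.IsPrivate X x z → ∀ y ∉ X,
      G.Adj x y → y = z := by
    intro x s x' z hq hz y hy hxy
    obtain ⟨x₁, s₁, x₁', hq₁, hx₁⟩ := h.exists_private_golden hl hirr h1 h0 hy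
    exact h.private_unique hirr hz ((hx₁.eq x hq.left.mem hxy.symm) ▸ hx₁)
  have hall : ∀ y, y ∈ {y | y = v ∨ y = u ∨ y = v' ∨ y = w' ∨ y = w} := by
    refine hG.mem_of_closed (a := v) (Or.inl rfl) ?_
    simp only [Set.mem_ofPred_eq]
    rintro t (rfl | rfl | rfl | rfl | rfl) y hty <;> by_cases hy : y ∈ X
    · exact Or.inr (Or.inl (hp.left.eq y hy hty))
    · simp [hend _ _ _ _ hp hw y hy hty]
    · rcases hp.center y hy hty with h | h <;> simp [h]
    · exact absurd hty (hprivu y hy)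
    · exact Or.inr (Or.inl (hp.right.eq y hy hty))
    · simp [hend _ _ _ _ hp.swap hw' y hy hty]
    · simp [hw'.eq y hy hty]
    · simp [h.eq_of_private_golden hl hirr h1 h0 hp.swap hw' hw hy hty]
    · simp [hw.eq y hy hty]
    · simp [h.eq_of_private_golden hl hirr h1 h0 hp hw hw' hy hty]
  have a1 := hp.left.adj
  have a2 := hp.right.adj
  have a3 := hw.adj
  have a4 := hw'.adj
  have n1 : ¬ G.Adj v v' := fun h => hp.right.adj.ne' (hp.left.eq _ hp.right.mem h).symm
  have n2 : ¬ G.Adj w u := fun h => hp.left.adj.ne' (hw.eq u hp.left.mem_nbr h)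
  have n3 : ¬ G.Adj w v' := fun h => hp.ne (hw.eq v' hp.right.mem h).symm
  have n4 : ¬ G.Adj w' u := fun h => hp.right.adj.ne' (hw'.eq u hp.left.mem_nbr h)
  have n5 : ¬ G.Adj w' v := fun h => hp.ne (hw'.eq v hp.left.mem h)
  have hadj : ∀ i j, G.Adj (![v, u, v', w', w] i) (![v, u, v', w', w] j)
      ↔ (cycleGraph 5).Adj i j := by
    intro i j
    fin_cases i <;> fin_cases j <;>
      simp [cycleGraph_adj, a1, a1.symm, a2, a2.symm, a3, a3.symm, a4, a4.symm, n1, n2, n3, n4, n5,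
        hww, hww.symm, mt Adj.symm n1, mt Adj.symm n2, mt Adj.symm n3, mt Adj.symm n4,
        mt Adj.symm n5] <;>
      decide
  refine nonempty_iso_of_bijective ![v, u, v', w', w] ⟨fun i j hij => ?_, fun y => ?_⟩ hadj
  · -- Distinct vertices of the cycle have distinct neighbourhoods.
    have htwin : ∀ i j : Fin 5, (∀ k, (cycleGraph 5).Adj i k ↔ (cycleGraph 5).Adj j k) →
        i = j := by decide
    exact htwin i j fun k => by rw [← hadj, ← hadj, hij]
  · rcases hall y with rfl | rfl | rfl | rfl | rfl
    exacts [⟨0, rfl⟩, ⟨1, rfl⟩, ⟨2, rfl⟩, ⟨3, rfl⟩, ⟨4, rfl⟩]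

/-! ### The extremal graphs from equality -/

theorem nonempty_iso_completeBipartiteGraph {V : Type*} [Fintype V] {G : SimpleGraph V}
    (p : V → Prop) [DecidablePred p] (h : ∀ u v, G.Adj u v ↔ (p u ↔ ¬ p v)) :
    Nonempty (G ≃g completeBipartiteGraph (Fin (Fintype.card {v // p v}))
      (Fin (Fintype.card {v // ¬ p v}))) := by
  refine nonempty_iso_of_bijective
    ((Equiv.sumCongr (Fintype.equivFin _) (Fintype.equivFin _)).symm.trans (Equiv.sumCompl p))
    (Equiv.bijective _) ?_
  have hp : ∀ a : {v // p v}, p a := fun a => a.2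
  have hn : ∀ a : {v // ¬ p v}, ¬ p a := fun a => a.2
  rintro (i | i) (j | j) <;> simp [h, hp, hn, -Subtype.coe_prop]

/-- For `lam = 0` each vertex sees exactly one end of a fixed edge of the induced matching, and
this end determines the side of the bipartition. -/
theorem IsTight.iso_completeBipartiteGraph (h : G.IsTight 0 X) (hG : G.Connected)
    (hlam : G.IsAdjEigenvalue 0) : ∃ r s : ℕ, 0 < r ∧ 0 < s ∧
      Nonempty (G ≃g completeBipartiteGraph (Fin r) (Fin s)) := by
  have h1 : (0 : ℝ) ^ 2 ≠ 1 := by norm_num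
  obtain ⟨m, hm⟩ := h.exists_mate h1 (by norm_num)
  have hd : ∀ i j : ℕ, (0 : ℝ) * i + j = 0 → j = 0 := fun i j hij => by
    rw [zero_mul, zero_add] at hij
    exact_mod_cast hij
  obtain ⟨y, hy⟩ := h.star.exists_notMem hlam
  obtain ⟨x, hx, hyx⟩ := h.star.exists_adj h.noIsolated_univ hy
  have hl := hm x hx
  have hl' := hm (m x) hl.mem_nbr
  rw [mate_mate hm hx] at hl'
  -- For `lam = 0` the equation of a pair says that adjacency is the number of crossings.
  have heq : ∀ u ∉ X, ∀ v ∉ X, u ≠ v →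
      (G.Adj u v ↔ ∃ z ∈ X, G.Adj u z ∧ G.Adj v (m z)) := by
    intro u hu v hv huv
    have h3 := h.mate_equation hm hv hu
    rw [if_neg huv] at h3
    constructor
    · intro hadj
      by_contra! hno
      have h4 : ({z ∈ X | G.Adj u z ∧ G.Adj v (m z)} : Finset V) = ∅ :=
        filter_false_of_mem fun z hz hz' => hno z hz hz'.1 hz'.2
      rw [if_pos hadj, h4] at h3
      norm_num at h3
    · rintro ⟨z, hz, huz, hvz⟩
      by_contra hadj
      rw [if_neg hadj, mul_zero, mul_zero, add_zero] at h3
      exact filter_eq_empty_iff.1 (card_eq_zero.1 (hd _ _ h3)) hz ⟨huz, hvz⟩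
  have hside : ∀ v, G.Adj v x ∨ G.Adj v (m x) := by
    refine hG.mem_of_closed (T := {v | G.Adj v x ∨ G.Adj v (m x)}) (a := y) (Or.inl hyx) ?_
    have hmeet : ∀ v ∉ X, G.Adj v x ∨ G.Adj v (m x) → ∀ z ∈ X, G.Adj v z → z = x ∨ z = m x := by
      rintro v hv (hvx | hvx) z hz hvz
      · exact h.eq_or_eq_mate hm hd hv hx hz hvx hvz
      · have := h.eq_or_eq_mate hm hd hv hl.mem_nbr hz hvx hvz
        rw [mate_mate hm hx] at this
        exact this.symm
    intro v hv u hvu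
    by_cases hvX : v ∈ X
    · rcases hv with hv | hv
      · obtain rfl := hl.eq v hvX hv.symm
        exact Or.inr hvu.symm
      · obtain rfl := hl'.eq v hvX hv.symm
        exact Or.inl hvu.symm
    by_cases huX : u ∈ X
    · rcases hmeet v hvX hv u huX hvu with rfl | rfl
      · exact Or.inr hl.adj
      · exact Or.inl hl.adj.symm
    obtain ⟨z, hz, huz, hvz⟩ := (heq u huX v hvX hvu.ne').1 hvu.symm
    rcases hmeet v hvX hv (m z) (hm z hz).mem_nbr hvz with h4 | h4
    · rw [← mate_mate hm hz, h4] at huz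
      exact Or.inr huz
    · have h5 : z = x := by rw [← mate_mate hm hz, h4, mate_mate hm hx]
      exact Or.inl (h5 ▸ huz)
  have hnot : ∀ v, G.Adj v x → ¬ G.Adj v (m x) := by
    intro v hvx hvm
    by_cases hv : v ∈ X
    · obtain rfl := hl.eq v hv hvx.symm
      exact G.irrefl hvm
    · rcases h.self_equation h1 hm hd hv hx hvx with h4 | h4
      · exact h4.1 hvm
      · norm_num at h4
  have hiff : ∀ v, ¬ G.Adj v (m x) ↔ G.Adj v x := fun v =>
    ⟨fun h4 => (hside v).resolve_right h4, hnot v⟩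
  have hXeq : ∀ v ∈ X, v = x ∨ v = m x := fun v hv => by
    rcases hside v with h4 | h4
    · exact Or.inr (hl.eq v hv h4.symm)
    · exact Or.inl (hl'.eq v hv h4.symm)
  have hadj : ∀ u v, G.Adj u v ↔ (G.Adj u (m x) ↔ ¬ G.Adj v (m x)) := by
    intro u v
    by_cases hu : u ∈ X
    · rcases hXeq u hu with rfl | rfl
      · simp only [hl.adj, hiff, true_iff]
        exact G.adj_comm _ _
      · simp [G.adj_comm v]
    by_cases hv : v ∈ X
    · rcases hXeq v hv with rfl | rfl
      · simp only [hl.adj, not_true, iff_false, hiff]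
      · simp
    by_cases huv : u = v
    · subst huv
      simp
    rw [heq u hu v hv huv]
    constructor
    · rintro ⟨z, hz, huz, hvz⟩
      rcases hXeq z hz with rfl | rfl
      · simp [hnot u huz, hvz]
      · rw [mate_mate hm hx] at hvz
        simp [huz, hnot v hvz]
    · intro h4
      by_cases hum : G.Adj u (m x)
      · exact ⟨m x, hl.mem_nbr, hum, by rw [mate_mate hm hx]; exact (hiff v).1 (h4.1 hum)⟩
      · exact ⟨x, hx, (hiff u).1 hum, by_contra fun h5 => hum (h4.2 h5)⟩
  refine ⟨_, _, ?_, ?_, nonempty_iso_completeBipartiteGraph (fun v => G.Adj v (m x)) hadj⟩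
  · exact Fintype.card_pos_iff.2 ⟨⟨x, hl.adj⟩⟩
  · exact Fintype.card_pos_iff.2 ⟨⟨m x, G.irrefl⟩⟩

/-- For `lam > 1` all terms of `IsTight.mate_equation` are nonnegative, so vertices outside `X` are
pairwise disjoint in the sense of `IsTight.eq_of_disjoint`. -/
theorem IsTight.iso_top (h : G.IsTight lam X) (hG : G.Connected)
    (hlam : G.IsAdjEigenvalue lam) (h1 : 1 < lam) (h2 : lam ^ 2 ≠ 2) :
    lam = 2 ∧ Nonempty (G ≃g (⊤ : SimpleGraph (Fin 3))) := by
  have hsq : 1 < lam ^ 2 := by nlinarith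
  obtain ⟨m, hm⟩ := h.exists_mate hsq.ne' (by linarith)
  have hd : ∀ i j : ℕ, lam * i + j = 0 → j = 0 := fun i j hij => by
    have : (0 : ℝ) ≤ lam * i := by positivity
    have : (j : ℝ) = 0 := le_antisymm (by linarith) (by positivity)
    exact_mod_cast this
  obtain ⟨y, hy⟩ := h.star.exists_notMem hlam
  obtain ⟨x, hx, hyx⟩ := h.star.exists_adj h.noIsolated_univ hy
  have hl := (hm x hx).adj
  obtain ⟨-, h3⟩ | ⟨hym, h3⟩ := h.self_equation hsq.ne' hm hd hy hx hyx
  · rcases mul_eq_zero.1 h3 with h4 | h4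
    · linarith
    · exact absurd (by linarith) h2
  refine ⟨h3, ?_⟩
  have hall := h.eq_of_disjoint hG hm hd (fun i j a _ hija => by
    rw [h3] at hija
    have : 2 * i + j + 3 * a = 0 := by
      have : ((2 * i + j + 3 * a : ℕ) : ℝ) = 0 := by push_cast; linarith
      exact_mod_cast this
    omega) hy hx hyx
  refine nonempty_iso_of_bijective ![x, m x, y] ⟨?_, fun v => ?_⟩ ?_
  · intro i j
    fin_cases i <;> fin_cases j <;> simp [hl.ne, hl.ne', hyx.ne, hyx.ne', hym.ne, hym.ne']
  · rcases hall v with rfl | rfl | rfl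
    exacts [⟨0, rfl⟩, ⟨1, rfl⟩, ⟨2, rfl⟩]
  · intro i j
    fin_cases i <;> fin_cases j <;> simp [hl, hl.symm, hyx, hyx.symm, hym, hym.symm]

/-- For irrational `lam` with `lam ^ 2 + lam ≠ 1`, the terms of `IsTight.mate_equation` cannot
cancel because `1` and `lam` are linearly independent over the rationals. -/
theorem IsTight.iso_star (h : G.IsTight lam X) (hG : G.Connected)
    (hlam : G.IsAdjEigenvalue lam) (hirr : Irrational lam) (h1 : lam ^ 2 ≠ 1)
    (h2 : lam ^ 2 + lam ≠ 1) :
    lam ^ 2 = 2 ∧ Nonempty (G ≃g completeBipartiteGraph (Fin 1) (Fin 2)) := by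
  obtain ⟨m, hm⟩ := h.exists_mate h1 h2
  have hd' : ∀ i j : ℕ, lam * i + j = 0 → i = 0 ∧ j = 0 := fun i j hij => by
    have hi : i = 0 := by
      by_contra hi
      have hi' : (i : ℝ) ≠ 0 := by exact_mod_cast hi
      refine hirr ⟨-j / i, ?_⟩
      push_cast
      rw [div_eq_iff hi']
      linarith
    subst hi
    simpa using hij
  have hd : ∀ i j : ℕ, lam * i + j = 0 → j = 0 := fun i j hij => (hd' i j hij).2
  obtain ⟨y, hy⟩ := h.star.exists_notMem hlam
  obtain ⟨x, hx, hyx⟩ := h.star.exists_adj h.noIsolated_univ hy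
  have hl := (hm x hx).adj
  obtain ⟨hym, h3⟩ | ⟨-, h3⟩ := h.self_equation h1 hm hd hy hx hyx
  swap
  · exact absurd ⟨2, by rw [h3]; norm_num⟩ hirr
  have hsq : lam ^ 2 = 2 := by
    rcases mul_eq_zero.1 h3 with h4 | h4
    · exact absurd h4 hirr.ne_zero
    · linarith
  refine ⟨hsq, ?_⟩
  have hall := h.eq_of_disjoint hG hm hd (fun i j a _ hija => by
    have := hd' i (j + a) (by push_cast; rw [hsq] at hija; linarith)
    omega) hy hx hyx
  have hne : m x ≠ y := fun he => hy (he ▸ (hm x hx).mem_nbr)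
  have hmy : ¬ G.Adj (m x) y := fun h => hym h.symm
  refine nonempty_iso_of_bijective (Sum.elim (fun _ => x) ![m x, y]) ⟨?_, fun v => ?_⟩ ?_
  · rintro (i | i) (j | j) <;> fin_cases i <;> fin_cases j <;>
      simp [hl.ne, hl.ne', hyx.ne, hyx.ne', hne, hne.symm]
  · rcases hall v with rfl | rfl | rfl
    exacts [⟨Sum.inl 0, rfl⟩, ⟨Sum.inr 0, rfl⟩, ⟨Sum.inr 1, rfl⟩]
  · rintro (i | i) (j | j) <;> fin_cases i <;> fin_cases j <;>
      simp [hl, hl.symm, hyx, hyx.symm, hym, hmy]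

/-! ### Equality for the extremal graphs -/

theorem IsTotalDominatingSet.two_le_card {V : Type*} [Nonempty V] {G : SimpleGraph V}
    {S : Finset V} (hS : G.IsTotalDominatingSet S) : 2 ≤ #S := by
  obtain ⟨u, hu, -⟩ := hS (Classical.arbitrary V)
  obtain ⟨w, hw, huw⟩ := hS u
  exact one_lt_card.2 ⟨u, hu, w, hw, huw.ne⟩

/-- Dual eigenvectors and total dominating sets are transported along an isomorphism. -/
theorem Iso.card_sub_adjMultiplicity_le {W : Type*} [Fintype W] [DecidableEq W]
    {H : SimpleGraph W} [DecidableRel H.Adj] (e : G ≃g H) {Y : Finset W}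
    (hY : ∀ y ∉ Y, ∃ g, H.IsDualEigenvector lam Y y g)
    (hS : ∀ S, H.IsTotalDominatingSet S → #Y ≤ #S) (S : Finset V)
    (hSG : G.IsTotalDominatingSet S) : Fintype.card V - G.adjMultiplicity lam ≤ #S := by
  have h1 : Fintype.card W ≤ #Y + H.adjMultiplicity lam := card_compl_le_adjMultiplicity hY
  have h2 : Fintype.card V ≤ #(Y.map e.symm.toEquiv.toEmbedding) + G.adjMultiplicity lam := by
    refine card_compl_le_adjMultiplicity fun y hy => ?_
    have hmem : ∀ v, v ∉ Y.map e.symm.toEquiv.toEmbedding → e v ∉ Y := by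
      intro v hv hev
      exact hv (mem_map.2 ⟨e v, hev, e.symm_apply_apply v⟩)
    obtain ⟨g, hg⟩ := hY (e y) (hmem y hy)
    refine ⟨g ∘ e, mem_adjEigenspace_iff.2 fun v => ?_, hg.self, fun v hv hvy =>
      hg.off _ (hmem v hv) (e.injective.ne hvy)⟩
    rw [Function.comp_apply, ← mem_adjEigenspace_iff.1 hg.mem (e v)]
    refine sum_equiv e.toEquiv (fun u => ?_) fun u _ => rfl
    simp only [mem_neighborFinset]
    exact e.map_adj_iff.symm
  have h3 : #Y ≤ #(S.map e.toEquiv.toEmbedding) := by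
    refine hS _ fun v => ?_
    obtain ⟨u, hu, hvu⟩ := hSG (e.symm v)
    refine ⟨e u, mem_map.2 ⟨u, hu, rfl⟩, ?_⟩
    rw [← e.apply_symm_apply v]
    exact e.map_adj_iff.2 hvu
  rw [card_map] at h2 h3
  omega

theorem totalDominationEquality_of_iso_cycleGraph (hG : G.Connected) (hirr : Irrational lam)
    (hl : lam ^ 2 + lam = 1) (e : G ≃g cycleGraph 5) : G.TotalDominationEquality lam := by
  have h1 : lam ^ 2 ≠ 1 := fun h => hirr.ne_zero (by linarith)
  have hab : G.Adj (e.symm 0) (e.symm 1) := e.symm.map_adj_iff.2 (by decide)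
  refine totalDominationEquality_of_le hG h1 hab
    (e.card_sub_adjMultiplicity_le (Y := {0, 1, 2}) ?_ (by unfold IsTotalDominatingSet; decide))
  -- The eigenspace is two-dimensional, so there are dual eigenvectors for the vertices `3` and `4`.
  have hdual : ∀ (y : Fin 5) (g : Fin 5 → ℝ), g y = 1 →
      (∀ v ∉ ({0, 1, 2} : Finset (Fin 5)), v ≠ y → g v = 0) →
      g 4 + g 1 = lam * g 0 → g 0 + g 2 = lam * g 1 → g 1 + g 3 = lam * g 2 →
      g 2 + g 4 = lam * g 3 → g 3 + g 0 = lam * g 4 →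
      (cycleGraph 5).IsDualEigenvector lam {0, 1, 2} y g := by
    intro y g hy hoff h0 h1 h2 h3 h4
    refine ⟨mem_adjEigenspace_iff.2 fun v => ?_, hy, hoff⟩
    have hn : ∀ v, (cycleGraph 5).neighborFinset v = {v - 1, v + 1} := by decide
    rw [hn, sum_pair (by revert v; decide)]
    fin_cases v
    exacts [h0, h1, h2, h3, h4]
  intro y hy
  fin_cases y
  · simp at hy
  · simp at hy
  · simp at hy
  · refine ⟨![-1, -lam, lam, 1, 0], hdual _ _ rfl ?_ ?_ ?_ ?_ ?_ ?_⟩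
    · intro v; fin_cases v <;> simp
    all_goals simp
    all_goals linarith
  · refine ⟨![lam, -lam, -1, 0, 1], hdual _ _ rfl ?_ ?_ ?_ ?_ ?_ ?_⟩
    · intro v; fin_cases v <;> simp
    all_goals simp
    all_goals linarith

theorem totalDominationEquality_of_iso_completeBipartiteGraph (hG : G.Connected) {r s : ℕ}
    (hr : 0 < r) (hs : 0 < s) (e : G ≃g completeBipartiteGraph (Fin r) (Fin s)) :
    G.TotalDominationEquality 0 := by
  classical
  have : NeZero r := ⟨hr.ne'⟩
  have : NeZero s := ⟨hs.ne'⟩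
  have hab : G.Adj (e.symm (Sum.inl 0)) (e.symm (Sum.inr 0)) :=
    e.symm.map_adj_iff.2 (by simp)
  refine totalDominationEquality_of_le hG (by norm_num) hab
    (e.card_sub_adjMultiplicity_le (Y := {Sum.inl 0, Sum.inr 0}) ?_ ?_)
  · rintro (i | i) hi
    · have hi0 : i ≠ 0 := by simpa using hi
      refine ⟨Pi.single (Sum.inl i) 1 - Pi.single (Sum.inl 0) 1,
        mem_adjEigenspace_iff.2 ?_, by simp [hi0], ?_⟩
      · rintro (v | v) <;> simp [neighborFinset_eq_filter, Pi.single_apply]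
      · rintro (v | v) hv hvi <;> simp_all
    · have hi0 : i ≠ 0 := by simpa using hi
      refine ⟨Pi.single (Sum.inr i) 1 - Pi.single (Sum.inr 0) 1,
        mem_adjEigenspace_iff.2 ?_, by simp [hi0], ?_⟩
      · rintro (v | v) <;> simp [neighborFinset_eq_filter, Pi.single_apply]
      · rintro (v | v) hv hvi <;> simp_all
  · intro S hS
    rw [card_pair (by simp)]
    exact hS.two_le_card

theorem totalDominationEquality_of_iso_star (hG : G.Connected) (hlam : G.IsAdjEigenvalue lam)
    (h1 : lam ^ 2 ≠ 1) (e : G ≃g completeBipartiteGraph (Fin 1) (Fin 2)) :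
    G.TotalDominationEquality lam := by
  have hab : G.Adj (e.symm (Sum.inl 0)) (e.symm (Sum.inr 0)) :=
    e.symm.map_adj_iff.2 (by simp)
  have := hG.nonempty
  refine totalDominationEquality_of_le hG h1 hab fun S hS => ?_
  have h2 := hlam.adjMultiplicity_pos
  have h3 : Fintype.card V = 3 := by rw [Fintype.card_congr e.toEquiv]; rfl
  have h4 := hS.two_le_card
  omega

/-! ### Integrality of eigenvalues -/

theorem IsAdjEigenvalue.isIntegral (hlam : G.IsAdjEigenvalue lam) : IsIntegral ℤ lam := by
  have h1 := (Module.End.hasEigenvalue_iff_isRoot_charpoly _ _).1 hlam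
  rw [Matrix.charpoly_toLin'] at h1
  have h2 : G.adjMatrix ℝ = (G.adjMatrix ℤ).map (Int.castRingHom ℝ) := by
    ext i j
    simp [adjMatrix_apply]
  rw [h2, Matrix.charpoly_map] at h1
  refine ⟨_, Matrix.charpoly_monic (G.adjMatrix ℤ), ?_⟩
  rw [← Polynomial.eval_map]
  exact h1

end Tight

end SimpleGraph

theorem mainTheorem2 {V : Type*} [Fintype V] [DecidableEq V] (G : SimpleGraph V)
    [DecidableRel G.Adj] (hG : G.Connected) (lam : ℝ) (hlam : G.IsAdjEigenvalue lam) :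
    (Irrational lam →
      (G.TotalDominationEquality lam ↔
        ((lam = (-1 + √5) / 2 ∨ lam = (-1 - √5) / 2) ∧
            Nonempty (G ≃g SimpleGraph.cycleGraph 5)) ∨
        ((lam = √2 ∨ lam = -√2) ∧
            Nonempty (G ≃g completeBipartiteGraph (Fin 1) (Fin 2))))) ∧
    ((∃ q : ℚ, lam = (q : ℝ)) →
      (∃ k : ℤ, lam = (k : ℝ)) ∧
      (G.TotalDominationEquality lam →
        ¬ (lam = 2 ∧ Nonempty (G ≃g (⊤ : SimpleGraph (Fin 3)))) → lam ≤ 1)) ∧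
    (lam = 0 →
      (G.TotalDominationEquality lam ↔
        ∃ r s : ℕ, 0 < r ∧ 0 < s ∧
          Nonempty (G ≃g completeBipartiteGraph (Fin r) (Fin s)))) := by
  refine ⟨fun hirr => ?_, fun hrat => ⟨?_, fun h hne => ?_⟩, ?_⟩
  · have h5 : √5 ^ 2 = 5 := Real.sq_sqrt (by norm_num)
    have h2 : √2 ^ 2 = 2 := Real.sq_sqrt (by norm_num)
    have hsq : lam ^ 2 ≠ 1 := fun h => by
      rcases sq_eq_sq_iff_eq_or_eq_neg.1 (h.trans (one_pow 2).symm) with h | h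
      · exact hirr ⟨1, by simp [h]⟩
      · exact hirr ⟨-1, by simp [h]⟩
    constructor
    · intro h
      obtain ⟨X, hX⟩ := h.exists_isTight hG hsq
      by_cases hl : lam ^ 2 + lam = 1
      · refine Or.inl ⟨?_, hX.iso_cycleGraph hG hlam hl hirr⟩
        have h3 : (lam - (-1 + √5) / 2) * (lam - (-1 - √5) / 2) = 0 := by
          linear_combination hl - h5 / 4
        exact (mul_eq_zero.1 h3).imp sub_eq_zero.1 sub_eq_zero.1
      · obtain ⟨h3, h4⟩ := hX.iso_star hG hlam hirr hsq hl
        refine Or.inr ⟨?_, h4⟩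
        rw [← h2] at h3
        exact sq_eq_sq_iff_eq_or_eq_neg.1 h3
    · rintro (⟨hl, ⟨e⟩⟩ | ⟨-, ⟨e⟩⟩)
      · refine SimpleGraph.totalDominationEquality_of_iso_cycleGraph hG hirr ?_ e
        rcases hl with rfl | rfl <;> linear_combination h5 / 4
      · exact SimpleGraph.totalDominationEquality_of_iso_star hG hlam hsq e
  · obtain ⟨q, rfl⟩ := hrat
    have h1 : IsIntegral ℤ q :=
      (isIntegral_algebraMap_iff (algebraMap ℚ ℝ).injective).1 hlam.isIntegral
    obtain ⟨k, hk⟩ := IsIntegrallyClosed.isIntegral_iff.1 h1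
    exact ⟨k, by rw [← hk]; simp⟩
  · by_contra! h1
    obtain ⟨X, hX⟩ := h.exists_isTight hG (by nlinarith)
    refine hne (hX.iso_top hG hlam h1 fun h2 => ?_)
    obtain ⟨q, hq⟩ := hrat
    have h3 : lam = √2 := by
      rw [← h2, Real.sqrt_sq (by linarith)]
    exact irrational_sqrt_two ⟨q, by rw [← hq, h3]⟩
  · rintro rfl
    constructor
    · intro h
      obtain ⟨X, hX⟩ := h.exists_isTight hG (by norm_num)
      exact hX.iso_completeBipartiteGraph hG hlam
    · rintro ⟨r, s, hr, hs, ⟨e⟩⟩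
      exact SimpleGraph.totalDominationEquality_of_iso_completeBipartiteGraph hG hr hs e
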